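/- Let $(a,b)\subseteq\mathbb R$ be a non-empty open interval, possibly unbounded, and let $\rho(z,\varepsilon)$ be a real function (for instance a polynomial) that is analytic near $(a,b)\times\{0\}$ and satisfies $\rho(z,0)>0$ on $(a,b)$. Let $C^\omega(a,b)$ be the complex-valued real-analytic functions on $(a,b)$. Functions $F(z,\varepsilon)$ are read as formal power series in $\varepsilon$ with coefficients in $C^\omega(a,b)$; in particular $\rho$ is replaced by its Taylor series in $\varepsilon$, and $F(z+c\,\varepsilon,\varepsilon)$ is expanded in powers of $\varepsilon$. *Noncommutative surface of rotation.* $\mathcal A_\rho$ is the complex algebra generated by $X_+,X_-$ and the elements $F(X_0,\varepsilon)$, $F\in C^\omega(a,b)[[\varepsilon]]$ (with $F\mapsto F(X_0,\varepsilon)$ an algebra homomorphism), subject to $F(X_0,\varepsilon)X_\pm=X_\pm F(X_0\pm\varepsilon,\varepsilon)$ (in particular $\varepsilon$ is central and $[X_0,X_\pm]=\pm\varepsilon X_\pm$) and $$[X_+,X_-]=\rho(X_0-\tfrac\varepsilon2,\varepsilon)-\rho(X_0+\tfrac\varepsilon2,\varepsilon),\qquad X_+X_-+X_-X_+=\rho(X_0-\tfrac\varepsilon2,\varepsilon)+\rho(X_0+\tfrac\varepsilon2,\varepsilon).$$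 Put $\mathcal A^0=\mathcal A_\rho/(\varepsilon)$, with quotient map $\pi$. *Heisenberg algebra.* $\mathcal H$ is the algebra of formal series $\sum_t\varepsilon^tu_t$, each $u_t$ a finite sum of terms $f(p)g(q)$ with $f\in C^\omega(a,b)$, $g\in C^\omega(\mathbb R)$, where $\varepsilon$ is central and $[q,p]=i\varepsilon$, that is, $g(q)f(p)=\sum_k\frac{(i\varepsilon)^k}{k!}f^{(k)}(p)g^{(k)}(q)$. Setting $\varepsilon=0$ gives the map $\pi$ of $\mathcal H$ onto the commutative algebra $\mathcal H^0$ of finite sums of functions $f(p)g(q)$. The Wick ordering $\Omega_W:\mathcal H^0\to\mathcal H$ is the linear map that sends $p^mq^n$ to the average of all distinct words with $m$ letters $p$ and $n$ letters $q$, and whose $\varepsilon^n$-coefficients, when values are written with $p$ to the left of $q$, are differential operators with coefficients in $\mathcal H^0$. *Theorem.* 1. The map $\Omega_W$ exists and is unique. There is a unique algebra homomorphism $\Psi:\mathcal A_\rho\to\mathcal H$ with $\Psi(\varepsilon)=\varepsilon$, $\Psi(F(X_0,\varepsilon))=F(p,\varepsilon)$ and $\Psi(X_\pm)=e^{\pm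 iq}\rho(p\pm\frac\varepsilon2,\varepsilon)^{1/2}$ (positive square root). Both $\Psi$ and the induced map $\Psi^0:\mathcal A^0\to\mathcal H^0$, $\Psi^0\circ\pi=\pi\circ\Psi$, are injective. 2. There is a unique linear map $\Omega_C:\mathcal A^0\to\mathcal A_\rho$ (the central ordering) such that $\Psi(\Omega_C(u))=e^{irq}f(p+\frac{r\varepsilon}2)$ whenever $\Psi^0(u)=e^{irq}f(p)$ with $r\in\mathbb Z$, $f\in C^\omega(a,b)$. It is an ordering: it is injective, $\pi\circ\Omega_C=\mathrm{id}$ and $\Omega_C(1)=1$. 3. $\Psi\circ\Omega_C=\Omega_W\circ\Psi^0$. 4. The central ordering gives the Vey product. For all $u,v\in\mathcal A^0$ there is a unique sequence $C_k(u,v)\in\mathcal A^0$ with $\Omega_C(u)\Omega_C(v)=\sum_k\varepsilon^k\,\Omega_C(C_k(u,v))$ (that is, for every $N$ the difference of the left side and the sum over $k<N$ lies in $\varepsilon^N\mathcal A_\rho$), and $$\Psi^0(C_k(u,v))=\frac1{k!}\Big(\frac i2P\Big)^k(\Psi^0u,\Psi^0v),\qquad P=\frac{\partial_1}{\partial q}\frac{\partial_2}{\partial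 p}-\frac{\partial_1}{\partial p}\frac{\partial_2}{\partial q},$$ the indices $1,2$ meaning differentiation of the first and second argument. Here $P$ is the Poisson bracket $\{\pi(x),\pi(y)\}=\pi\big(\frac1{i\varepsilon}[x,y]\big)$ of $\mathcal A^0$: for all $x,y\in\mathcal A_\rho$ there is $w$ with $[x,y]=i\varepsilon w$, and then $\Psi^0(\pi(w))=P(\Psi^0\pi(x),\Psi^0\pi(y))$. -/

import Mathlib

open scoped TensorProduct PowerSeries

/-! ### Analytic functions on an interval -/

/-- The open interval `(a, b)` of real numbers, with possibly infinite end points. -/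
def realIoo (a b : EReal) : Set ℝ := {z | a < (z : EReal) ∧ (z : EReal) < b}

theorem isOpen_realIoo (a b : EReal) : IsOpen (realIoo a b) :=
  (isOpen_lt continuous_const continuous_coe_real_ereal).inter
    (isOpen_lt continuous_coe_real_ereal continuous_const)

open Classical in
/-- Extension by zero of a function on `(a, b)`. -/
noncomputable def extZero {a b : EReal} (f : realIoo a b → ℂ) (t : ℝ) : ℂ :=
  if h : t ∈ realIoo a b then f ⟨t, h⟩ else 0

theorem extZero_eventuallyEq {a b : EReal} {f : realIoo a b → ℂ} {F : ℝ → ℂ}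
    (h : ∀ z : realIoo a b, f z = F z) {t : ℝ} (ht : t ∈ realIoo a b) :
    extZero f =ᶠ[nhds t] F := by
  filter_upwards [(isOpen_realIoo a b).mem_nhds ht] with s hs
  simp [extZero, hs, h]

theorem extZero_apply {a b : EReal} (f : realIoo a b → ℂ) (z : realIoo a b) :
    extZero f z = f z := by
  simp [extZero, z.2]

/-- `C^ω(a, b)`: the algebra of complex valued real-analytic functions on `(a, b)`. -/
noncomputable def AnFun (a b : EReal) : Subalgebra ℂ (realIoo a b → ℂ) where
  carrier := {f | AnalyticOnNhd ℝ (extZero f) (realIoo a b)}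
  mul_mem' {f g} hf hg t ht := by
    refine ((hf t ht).mul (hg t ht)).congr (extZero_eventuallyEq ?_ ht).symm
    intro z
    simp [extZero_apply]
  add_mem' {f g} hf hg t ht := by
    refine ((hf t ht).add (hg t ht)).congr (extZero_eventuallyEq ?_ ht).symm
    intro z
    simp [extZero_apply]
  algebraMap_mem' c t ht := by
    refine (analyticAt_const (v := c)).congr (extZero_eventuallyEq ?_ ht).symm
    intro z
    rfl

/-- A function which is analytic on `(a, b)`, as an element of `C^ω(a, b)`. -/
noncomputable def AnFun.of {a b : EReal} (F : ℝ → ℂ) (hF : AnalyticOnNhd ℝ F (realIoo a b)) :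
    AnFun a b :=
  ⟨fun z => F z, fun t ht => (hF t ht).congr (extZero_eventuallyEq (fun _ => rfl) ht).symm⟩

/-- The derivative on `C^ω(a, b)`. -/
noncomputable def AnFun.deriv {a b : EReal} : Derivation ℂ (AnFun a b) (AnFun a b) :=
  Derivation.mk'
    { toFun := fun f => AnFun.of (_root_.deriv (extZero f.1)) f.2.deriv
      map_add' := fun f g => by
        ext z
        change _root_.deriv (extZero (f.1 + g.1)) z
          = _root_.deriv (extZero f.1) z + _root_.deriv (extZero g.1) z
        rw [← deriv_add (f.2 z z.2).differentiableAt (g.2 z z.2).differentiableAt]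
        refine Filter.EventuallyEq.deriv_eq (extZero_eventuallyEq ?_ z.2)
        intro w
        simp [extZero_apply]
      map_smul' := fun c f => by
        ext z
        change _root_.deriv (extZero (c • f.1)) z = c * _root_.deriv (extZero f.1) z
        rw [← deriv_const_mul c (f.2 z z.2).differentiableAt]
        refine Filter.EventuallyEq.deriv_eq (extZero_eventuallyEq ?_ z.2)
        intro w
        simp [extZero_apply] }
    (fun f g => by
      ext z
      change _root_.deriv (extZero (f.1 * g.1)) z
        = f.1 z * _root_.deriv (extZero g.1) z + g.1 z * _root_.deriv (extZero f.1) z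
      have h := deriv_mul (f.2 z z.2).differentiableAt (g.2 z z.2).differentiableAt
      rw [extZero_apply, extZero_apply] at h
      rw [add_comm, mul_comm (g.1 z), ← h]
      refine Filter.EventuallyEq.deriv_eq (extZero_eventuallyEq ?_ z.2)
      intro w
      simp [extZero_apply])

/-- The coordinate function `z ↦ z` on `(a, b)`. -/
noncomputable def AnFun.coord (a b : EReal) : AnFun a b :=
  AnFun.of (fun t : ℝ => (t : ℂ)) fun t _ => Complex.ofRealCLM.analyticAt t

/-- The function `q ↦ e^{irq}` on the real line. -/
noncomputable def expFun (r : ℤ) : AnFun ⊥ ⊤ :=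
  AnFun.of (fun t : ℝ => Complex.exp (Complex.I * r * t)) fun t _ =>
    by
      have h : AnalyticAt ℝ (fun t : ℝ => Complex.I * r * (t : ℂ)) t :=
        analyticAt_const.mul (Complex.ofRealCLM.analyticAt t)
      exact (analyticAt_cexp.restrictScalars (𝕜 := ℝ)).comp h

/-- For a formal series `F(z, ε) = ∑ εⁿ Fₙ(z)` with `Fₙ ∈ C^ω(a, b)`, the series `F(z + cε, ε)`,
that is, `∑ ε^{k+l} cᵏ/k! F_l^{(k)}(z)`.  The variable of the formal series is `ε`. -/
noncomputable def epsShift {a b : EReal} (c : ℂ) (F : (AnFun a b)⟦X⟧) : (AnFun a b)⟦X⟧ :=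
  PowerSeries.mk fun n => ∑ kl ∈ Finset.HasAntidiagonal.antidiagonal n,
    (c ^ kl.1 / (kl.1.factorial : ℂ)) •
      ((AnFun.deriv (a := a) (b := b) : AnFun a b →ₗ[ℂ] AnFun a b) ^ kl.1)
        (PowerSeries.coeff kl.2 F)

theorem analyticAt_iteratedDeriv_snd (n : ℕ) {G : ℝ → ℝ → ℝ} {z e : ℝ}
    (hG : AnalyticAt ℝ (fun x : ℝ × ℝ => G x.1 x.2) (z, e)) :
    AnalyticAt ℝ (fun x : ℝ × ℝ => iteratedDeriv n (G x.1) x.2) (z, e) := by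
  induction n with
  | zero => simpa using hG
  | succ n ih =>
    have h : AnalyticAt ℝ (fun x : ℝ × ℝ =>
        fderiv ℝ (fun y : ℝ × ℝ => iteratedDeriv n (G y.1) y.2) x (0, 1)) (z, e) :=
      (ContinuousLinearMap.apply ℝ ℝ ((0 : ℝ), (1 : ℝ))).analyticAt _ |>.comp ih.fderiv
    refine h.congr ?_
    filter_upwards [ih.eventually_analyticAt] with x hx
    rw [iteratedDeriv_succ]
    have h1 : HasDerivAt (fun t : ℝ => (x.1, t)) ((0 : ℝ), (1 : ℝ)) x.2 :=
      (hasDerivAt_const _ _).prodMk (hasDerivAt_id _)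
    exact (hx.differentiableAt.hasFDerivAt.comp_hasDerivAt x.2 h1).deriv.symm

/-- The Taylor expansion in `ε` at `ε = 0` of a real function `ρ(z, ε)` which is analytic near
`(a, b) × {0}`: the formal series `∑ εⁿ (∂ⁿρ/∂εⁿ)(z, 0)/n!`. -/
noncomputable def epsTaylor {a b : EReal} (ρ : ℝ → ℝ → ℝ)
    (hρ : ∀ z ∈ realIoo a b, AnalyticAt ℝ (fun x : ℝ × ℝ => ρ x.1 x.2) (z, 0)) :
    (AnFun a b)⟦X⟧ :=
  PowerSeries.mk fun n =>
    AnFun.of (fun z => ((iteratedDeriv n (ρ z) 0 / (n.factorial : ℝ) : ℝ) : ℂ)) fun z hz =>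
      (Complex.ofRealCLM.analyticAt _).comp
        (((analyticAt_iteratedDeriv_snd n (hρ z hz)).comp
          (f := fun t : ℝ => (t, (0 : ℝ))) (analyticAt_id.prod analyticAt_const)).div_const)

/-- `s` is the positive square root of the formal series `F`: `s² = F`, and the leading
coefficient of `s` is a positive function. -/
def IsPosSqrt {a b : EReal} (s F : (AnFun a b)⟦X⟧) : Prop :=
  s * s = F ∧ ∀ z : realIoo a b, ∃ y : ℝ, 0 < y ∧ (PowerSeries.constantCoeff s).1 z = y

/-! ### The Heisenberg algebra with analytic functions of the generators -/

/-- The commutative algebra of finite sums of functions `f(p) g(q)`, with `f ∈ C^ω(a, b)` and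
`g ∈ C^ω(ℝ)`. -/
def Symb (a b : EReal) : Type := AnFun a b ⊗[ℂ] AnFun ⊥ ⊤

namespace Symb

noncomputable instance (a b : EReal) : CommRing (Symb a b) :=
  inferInstanceAs (CommRing (AnFun a b ⊗[ℂ] AnFun ⊥ ⊤))

noncomputable instance (a b : EReal) : Algebra ℂ (Symb a b) :=
  inferInstanceAs (Algebra ℂ (AnFun a b ⊗[ℂ] AnFun ⊥ ⊤))

variable {a b : EReal}

/-- The function `f(p) g(q)`. -/
noncomputable def tmul (f : AnFun a b) (g : AnFun ⊥ ⊤) : Symb a b := f ⊗ₜ[ℂ] g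

/-- The identification with the tensor product. -/
noncomputable def toTensor (a b : EReal) : Symb a b ≃ₐ[ℂ] AnFun a b ⊗[ℂ] AnFun ⊥ ⊤ :=
  (AlgEquiv.refl : (AnFun a b ⊗[ℂ] AnFun ⊥ ⊤) ≃ₐ[ℂ] AnFun a b ⊗[ℂ] AnFun ⊥ ⊤)

theorem toTensor_tmul (f : AnFun a b) (g : AnFun ⊥ ⊤) : toTensor a b (tmul f g) = f ⊗ₜ g := rfl

theorem toTensor_symm_tmul (f : AnFun a b) (g : AnFun ⊥ ⊤) :
    (toTensor a b).symm (f ⊗ₜ g) = tmul f g := rfl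

theorem tmul_mul_tmul (f f' : AnFun a b) (g g' : AnFun ⊥ ⊤) :
    tmul f g * tmul f' g' = tmul (f * f') (g * g') :=
  (toTensor a b).injective (by
    simp only [map_mul, toTensor_tmul, Algebra.TensorProduct.tmul_mul_tmul])

@[elab_as_elim]
theorem induction_on {motive : Symb a b → Prop} (u : Symb a b) (zero : motive 0)
    (tmul : ∀ f g, motive (tmul f g)) (add : ∀ u v, motive u → motive v → motive (u + v)) :
    motive u :=
  TensorProduct.induction_on (motive := motive) u zero tmul add

theorem add_tmul (f f' : AnFun a b) (g : AnFun ⊥ ⊤) :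
    tmul (f + f') g = tmul f g + tmul f' g := TensorProduct.add_tmul f f' g

theorem tmul_add (f : AnFun a b) (g g' : AnFun ⊥ ⊤) :
    tmul f (g + g') = tmul f g + tmul f g' := TensorProduct.tmul_add f g g'

/-- Functions of `p` alone. -/
noncomputable def ofP (a b : EReal) : AnFun a b →ₐ[ℂ] Symb a b :=
  (toTensor a b).symm.toAlgHom.comp Algebra.TensorProduct.includeLeft

end Symb

/-- `∂/∂p`. -/
noncomputable def dP (a b : EReal) : Symb a b →ₗ[ℂ] Symb a b :=
  (Symb.toTensor a b).symm.toLinearMap ∘ₗ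
    LinearMap.rTensor _ (AnFun.deriv (a := a) (b := b) : AnFun a b →ₗ[ℂ] AnFun a b) ∘ₗ
      (Symb.toTensor a b).toLinearMap

/-- `∂/∂q`. -/
noncomputable def dQ (a b : EReal) : Symb a b →ₗ[ℂ] Symb a b :=
  (Symb.toTensor a b).symm.toLinearMap ∘ₗ
    LinearMap.lTensor _ (AnFun.deriv (a := ⊥) (b := ⊤) : AnFun ⊥ ⊤ →ₗ[ℂ] AnFun ⊥ ⊤) ∘ₗ
      (Symb.toTensor a b).toLinearMap

theorem dP_tmul {a b : EReal} (f : AnFun a b) (g : AnFun ⊥ ⊤) :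
    dP a b (Symb.tmul f g) = Symb.tmul (AnFun.deriv f) g := rfl

theorem dQ_tmul {a b : EReal} (f : AnFun a b) (g : AnFun ⊥ ⊤) :
    dQ a b (Symb.tmul f g) = Symb.tmul f (AnFun.deriv g) := rfl

theorem dP_mul {a b : EReal} (u v : Symb a b) : dP a b (u * v) = dP a b u * v + u * dP a b v := by
  induction u using Symb.induction_on with
  | zero => simp
  | add u u' h h' => simp only [add_mul, map_add, h, h']; ring
  | tmul f g =>
    induction v using Symb.induction_on with
    | zero => simp
    | add v v' h h' => simp only [mul_add, map_add, h, h']; ring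
    | tmul f' g' =>
      simp only [dP_tmul, Symb.tmul_mul_tmul, Derivation.leibniz, smul_eq_mul, ← Symb.add_tmul]
      congr 1
      ring

theorem dQ_mul {a b : EReal} (u v : Symb a b) : dQ a b (u * v) = dQ a b u * v + u * dQ a b v := by
  induction u using Symb.induction_on with
  | zero => simp
  | add u u' h h' => simp only [add_mul, map_add, h, h']; ring
  | tmul f g =>
    induction v using Symb.induction_on with
    | zero => simp
    | add v v' h h' => simp only [mul_add, map_add, h, h']; ring
    | tmul f' g' =>
      simp only [dQ_tmul, Symb.tmul_mul_tmul, Derivation.leibniz, smul_eq_mul, ← Symb.tmul_add]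
      congr 1
      ring

theorem dP_dQ_comm (a b : EReal) : Commute (dP a b) (dQ a b) := by
  refine LinearMap.ext fun u => ?_
  rw [Module.End.mul_apply, Module.End.mul_apply]
  induction u using Symb.induction_on with
  | zero => simp
  | add u v h h' => simp only [map_add, h, h']
  | tmul f g => simp only [dP_tmul, dQ_tmul]

/-! ### Star products given by a pair of commuting derivations -/

theorem coeff_sum_antidiagonal {R : Type*} [CommRing R] (G : ℕ → ℕ → R⟦X⟧) {n N : ℕ} (h : n < N) :
    PowerSeries.coeff n (∑ k ∈ Finset.range N, ∑ ij ∈ Finset.HasAntidiagonal.antidiagonal k,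
        PowerSeries.X ^ k * G ij.1 ij.2) =
      PowerSeries.coeff n (∑ i ∈ Finset.range N, ∑ j ∈ Finset.range N,
        PowerSeries.X ^ (i + j) * G i j) := by
  rw [← Finset.sum_product', Finset.sum_sigma']
  have hs : (Finset.range N ×ˢ Finset.range N).filter (fun p => p.1 + p.2 < N) ⊆
      Finset.range N ×ˢ Finset.range N := Finset.filter_subset _ _
  rw [map_sum, map_sum, ← Finset.sum_subset hs]
  · refine Finset.sum_nbij' (fun x => x.2) (fun p => ⟨p.1 + p.2, p⟩) ?_ ?_ ?_ ?_ ?_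
    · rintro ⟨k, i, j⟩ hx
      simp only [Finset.mem_sigma, Finset.mem_range, Finset.HasAntidiagonal.mem_antidiagonal] at hx
      simp only [Finset.mem_filter, Finset.mem_product, Finset.mem_range]
      omega
    · rintro ⟨i, j⟩ hx
      simp only [Finset.mem_filter, Finset.mem_product, Finset.mem_range] at hx
      simp only [Finset.mem_sigma, Finset.mem_range, Finset.HasAntidiagonal.mem_antidiagonal]
      exact ⟨hx.2, trivial⟩
    · rintro ⟨k, i, j⟩ hx
      simp only [Finset.mem_sigma, Finset.mem_range, Finset.HasAntidiagonal.mem_antidiagonal] at hx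
      obtain ⟨_, rfl⟩ := hx
      rfl
    · rintro ⟨i, j⟩ _
      rfl
    · rintro ⟨k, i, j⟩ hx
      simp only [Finset.mem_sigma, Finset.mem_range, Finset.HasAntidiagonal.mem_antidiagonal] at hx
      obtain ⟨_, rfl⟩ := hx
      rfl
  · rintro ⟨i, j⟩ hp hq
    simp only [Finset.mem_filter, not_and, not_lt] at hq
    have := hq hp
    rw [PowerSeries.coeff_X_pow_mul', if_neg]
    simp only
    omega

theorem smul_choose_eq (c : ℂ) (i l j : ℕ) :
    c ^ (i + l) / ((i + l).factorial : ℂ) * (((i + l).choose i : ℕ) : ℂ) *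
        (c ^ j / (j.factorial : ℂ)) =
      c ^ (i + l + j) / ((i.factorial : ℂ) * (l.factorial : ℂ) * (j.factorial : ℂ)) := by
  have h1 : ((i + l).factorial : ℂ) ≠ 0 := by exact_mod_cast (i + l).factorial_ne_zero
  have h2 : (i.factorial : ℂ) ≠ 0 := by exact_mod_cast i.factorial_ne_zero
  have h3 : (l.factorial : ℂ) ≠ 0 := by exact_mod_cast l.factorial_ne_zero
  have h4 : (j.factorial : ℂ) ≠ 0 := by exact_mod_cast j.factorial_ne_zero
  have h5 : (((i + l).choose i : ℕ) : ℂ) * i.factorial * l.factorial = (i + l).factorial := by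
    rw [Nat.choose_symm_add]
    exact_mod_cast Nat.add_choose_mul_factorial_mul_factorial i l
  rw [← h5]
  have h6 : (((i + l).choose i : ℕ) : ℂ) ≠ 0 := by
    intro h0
    rw [h0] at h5
    exact h1 (by rw [← h5]; ring)
  field_simp
  ring

section StarProduct

variable {R : Type*} [CommRing R] [Algebra ℂ R]

/-- The coefficientwise action of a linear map on formal power series. -/
noncomputable def mapCoeff (d : R →ₗ[ℂ] R) : R⟦X⟧ →ₗ[ℂ] R⟦X⟧ where
  toFun u := PowerSeries.mk fun n => d (PowerSeries.coeff n u)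
  map_add' u v := by ext n; simp
  map_smul' c u := by ext n; simp

/-- The formal series `u ⋆ v = ∑ₖ εᵏ cᵏ/k! (Qᵏ u)(Pᵏ v)`. -/
noncomputable def starMul (c : ℂ) (P Q : R →ₗ[ℂ] R) (u v : R⟦X⟧) : R⟦X⟧ :=
  PowerSeries.mk fun n => ∑ kl ∈ Finset.HasAntidiagonal.antidiagonal n,
    (c ^ kl.1 / (kl.1.factorial : ℂ)) •
      PowerSeries.coeff kl.2 (mapCoeff (Q ^ kl.1) u * mapCoeff (P ^ kl.1) v)

theorem mapCoeff_pow (d : R →ₗ[ℂ] R) (k : ℕ) : mapCoeff (d ^ k) = mapCoeff d ^ k := by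
  induction k with
  | zero => ext u n; simp [mapCoeff]
  | succ k ih => rw [pow_succ', pow_succ', ← ih]; ext u n; simp [mapCoeff]

theorem mapCoeff_X_pow_mul (d : R →ₗ[ℂ] R) (N : ℕ) (u : R⟦X⟧) :
    mapCoeff d (PowerSeries.X ^ N * u) = PowerSeries.X ^ N * mapCoeff d u := by
  ext n
  simp only [mapCoeff, LinearMap.coe_mk, AddHom.coe_mk, PowerSeries.coeff_mk,
    PowerSeries.coeff_X_pow_mul']
  split_ifs <;> simp

theorem mapCoeff_mul {d : R →ₗ[ℂ] R} (hd : ∀ a b, d (a * b) = d a * b + a * d b) (u v : R⟦X⟧) :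
    mapCoeff d (u * v) = mapCoeff d u * v + u * mapCoeff d v := by
  ext n
  simp [mapCoeff, PowerSeries.coeff_mul, hd, Finset.sum_add_distrib]

theorem leibniz_pow_apply {S : Type*} [CommRing S] [Algebra ℂ S] {D : S →ₗ[ℂ] S}
    (hD : ∀ a b, D (a * b) = D a * b + a * D b) (k : ℕ) (u v : S) :
    (D ^ k) (u * v) = ∑ ij ∈ Finset.HasAntidiagonal.antidiagonal k,
      (k.choose ij.1) • ((D ^ ij.1) u * (D ^ ij.2) v) := by
  induction k with
  | zero => simp
  | succ k ih =>
    rw [pow_succ', Module.End.mul_apply, ih, map_sum,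
      Finset.sum_antidiagonal_choose_succ_nsmul (fun i j => (D ^ i) u * (D ^ j) v),
      ← Finset.sum_add_distrib]
    refine Finset.sum_congr rfl fun ij hij => ?_
    have hc : k.choose ij.1 = k.choose ij.2 := by
      rw [← Finset.HasAntidiagonal.mem_antidiagonal.mp hij, Nat.choose_symm_add]
    rw [map_nsmul, hD, pow_succ', pow_succ', ← hc]
    simp only [Module.End.mul_apply, nsmul_add]
    ring

theorem starMul_eq_trunc (c : ℂ) (P Q : R →ₗ[ℂ] R) (u v : R⟦X⟧) {n N : ℕ} (h : n < N) :
    PowerSeries.coeff n (starMul c P Q u v) =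
      PowerSeries.coeff n (∑ k ∈ Finset.range N, PowerSeries.X ^ k *
        ((c ^ k / (k.factorial : ℂ)) • ((mapCoeff Q ^ k) u * (mapCoeff P ^ k) v))) := by
  rw [starMul, PowerSeries.coeff_mk, Finset.Nat.sum_antidiagonal_eq_sum_range_succ_mk, map_sum]
  have hs : Finset.range n.succ ⊆ Finset.range N := Finset.range_subset_range.mpr h
  rw [← Finset.sum_subset hs]
  · refine Finset.sum_congr rfl fun k hk => ?_
    rw [PowerSeries.coeff_X_pow_mul', if_pos (Nat.lt_succ_iff.mp (Finset.mem_range.mp hk)),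
      mapCoeff_pow, mapCoeff_pow]
    simp
  · intro k _ hk
    rw [PowerSeries.coeff_X_pow_mul', if_neg]
    simpa [Nat.lt_succ_iff] using hk

theorem starMul_eq_add (c : ℂ) (P Q : R →ₗ[ℂ] R) (u v : R⟦X⟧) (N : ℕ) :
    ∃ z, starMul c P Q u v = (∑ k ∈ Finset.range N, PowerSeries.X ^ k *
        ((c ^ k / (k.factorial : ℂ)) • ((mapCoeff Q ^ k) u * (mapCoeff P ^ k) v)))
      + PowerSeries.X ^ N * z := by
  have h : (PowerSeries.X : R⟦X⟧) ^ N ∣ starMul c P Q u v - ∑ k ∈ Finset.range N,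
      PowerSeries.X ^ k *
        ((c ^ k / (k.factorial : ℂ)) • ((mapCoeff Q ^ k) u * (mapCoeff P ^ k) v)) := by
    rw [PowerSeries.X_pow_dvd_iff]
    intro m hm
    rw [map_sub, starMul_eq_trunc c P Q u v hm, sub_self]
  obtain ⟨z, hz⟩ := h
  exact ⟨z, by rw [← hz]; ring⟩

theorem starMul_assoc (c : ℂ) {P Q : R →ₗ[ℂ] R} (hP : ∀ a b, P (a * b) = P a * b + a * P b)
    (hQ : ∀ a b, Q (a * b) = Q a * b + a * Q b) (hPQ : Commute P Q) (u v w : R⟦X⟧) :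
    starMul c P Q (starMul c P Q u v) w = starMul c P Q u (starMul c P Q v w) := by
  have hP' := fun a b => mapCoeff_mul hP a b
  have hQ' := fun a b => mapCoeff_mul hQ a b
  have hc : Commute (mapCoeff P) (mapCoeff Q) := by
    ext s n
    simpa [mapCoeff] using LinearMap.congr_fun hPQ.eq (PowerSeries.coeff n s)
  have hXP : ∀ (k N : ℕ) (s : R⟦X⟧),
      (mapCoeff P ^ k) (PowerSeries.X ^ N * s) = PowerSeries.X ^ N * (mapCoeff P ^ k) s := by
    intro k N s
    rw [← mapCoeff_pow, mapCoeff_X_pow_mul]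
  have hXQ : ∀ (k N : ℕ) (s : R⟦X⟧),
      (mapCoeff Q ^ k) (PowerSeries.X ^ N * s) = PowerSeries.X ^ N * (mapCoeff Q ^ k) s := by
    intro k N s
    rw [← mapCoeff_pow, mapCoeff_X_pow_mul]
  ext n
  -- the common value of the two sides, up to terms of order `n + 1`
  let F : ℕ → ℕ → ℕ → R⟦X⟧ := fun i l j =>
    (c ^ (i + l + j) / ((i.factorial : ℂ) * (l.factorial : ℂ) * (j.factorial : ℂ))) •
      ((mapCoeff Q ^ (i + j)) u * (mapCoeff Q ^ l) ((mapCoeff P ^ j) v) *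
        (mapCoeff P ^ (i + l)) w)
  have key : ∀ (Z z : R⟦X⟧), PowerSeries.coeff n (Z + PowerSeries.X ^ (n + 1) * z) =
      PowerSeries.coeff n Z := by
    intro Z z
    rw [map_add, PowerSeries.coeff_X_pow_mul', if_neg (by omega), add_zero]
  have hL : PowerSeries.coeff n (starMul c P Q (starMul c P Q u v) w) =
      PowerSeries.coeff n (∑ j ∈ Finset.range (n + 1), ∑ i ∈ Finset.range (n + 1),
        ∑ l ∈ Finset.range (n + 1), PowerSeries.X ^ (i + l + j) * F i l j) := by
    obtain ⟨z, hz⟩ := starMul_eq_add c P Q u v (n + 1)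
    rw [starMul_eq_trunc c P Q _ w (Nat.lt_succ_self n), hz]
    have e1 : ∀ k, PowerSeries.X ^ k * ((c ^ k / (k.factorial : ℂ)) •
        ((mapCoeff Q ^ k) ((∑ j ∈ Finset.range (n + 1), PowerSeries.X ^ j *
          ((c ^ j / (j.factorial : ℂ)) • ((mapCoeff Q ^ j) u * (mapCoeff P ^ j) v)))
            + PowerSeries.X ^ (n + 1) * z) * (mapCoeff P ^ k) w)) =
        (∑ j ∈ Finset.range (n + 1), PowerSeries.X ^ j *
          ∑ il ∈ Finset.HasAntidiagonal.antidiagonal k, PowerSeries.X ^ k * F il.1 il.2 j)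
        + PowerSeries.X ^ (n + 1) * (PowerSeries.X ^ k * ((c ^ k / (k.factorial : ℂ)) •
          ((mapCoeff Q ^ k) z * (mapCoeff P ^ k) w))) := by
      intro k
      rw [map_add, hXQ, map_sum, add_mul, smul_add, mul_add]
      congr 1
      · rw [Finset.sum_mul, Finset.smul_sum, Finset.mul_sum]
        refine Finset.sum_congr rfl fun j _ => ?_
        rw [hXQ, map_smul, leibniz_pow_apply hQ', Finset.smul_sum, Finset.mul_sum,
          Finset.sum_mul, Finset.smul_sum, Finset.mul_sum, Finset.mul_sum]
        refine Finset.sum_congr rfl fun il hil => ?_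
        have hk : il.1 + il.2 = k := Finset.HasAntidiagonal.mem_antidiagonal.mp hil
        subst hk
        simp only [F]
        rw [← smul_choose_eq, pow_add (mapCoeff Q), ← Nat.cast_smul_eq_nsmul ℂ]
        simp only [Module.End.mul_apply, Algebra.smul_def, map_mul, map_natCast]
        ring
      · simp only [Algebra.smul_def]
        ring
    simp_rw [e1]
    rw [Finset.sum_add_distrib, ← Finset.mul_sum, key, Finset.sum_comm, map_sum, map_sum]
    refine Finset.sum_congr rfl fun j _ => ?_
    rw [← Finset.mul_sum]
    have e2 : (∑ i ∈ Finset.range (n + 1), ∑ l ∈ Finset.range (n + 1),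
        PowerSeries.X ^ (i + l + j) * F i l j) = PowerSeries.X ^ j *
        ∑ i ∈ Finset.range (n + 1), ∑ l ∈ Finset.range (n + 1),
          PowerSeries.X ^ (i + l) * F i l j := by
      simp only [Finset.mul_sum]
      refine Finset.sum_congr rfl fun i _ => Finset.sum_congr rfl fun l _ => ?_
      ring
    rw [e2, PowerSeries.coeff_X_pow_mul', PowerSeries.coeff_X_pow_mul']
    split_ifs with hj
    · exact coeff_sum_antidiagonal (fun i l => F i l j) (by omega)
    · rfl
  have hR : PowerSeries.coeff n (starMul c P Q u (starMul c P Q v w)) =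
      PowerSeries.coeff n (∑ l ∈ Finset.range (n + 1), ∑ j ∈ Finset.range (n + 1),
        ∑ i ∈ Finset.range (n + 1), PowerSeries.X ^ (i + l + j) * F i l j) := by
    obtain ⟨z, hz⟩ := starMul_eq_add c P Q v w (n + 1)
    rw [starMul_eq_trunc c P Q u _ (Nat.lt_succ_self n), hz]
    have e1 : ∀ k, PowerSeries.X ^ k * ((c ^ k / (k.factorial : ℂ)) •
        ((mapCoeff Q ^ k) u * (mapCoeff P ^ k) ((∑ l ∈ Finset.range (n + 1), PowerSeries.X ^ l *
          ((c ^ l / (l.factorial : ℂ)) • ((mapCoeff Q ^ l) v * (mapCoeff P ^ l) w)))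
            + PowerSeries.X ^ (n + 1) * z))) =
        (∑ l ∈ Finset.range (n + 1), PowerSeries.X ^ l *
          ∑ ji ∈ Finset.HasAntidiagonal.antidiagonal k, PowerSeries.X ^ k * F ji.2 l ji.1)
        + PowerSeries.X ^ (n + 1) * (PowerSeries.X ^ k * ((c ^ k / (k.factorial : ℂ)) •
          ((mapCoeff Q ^ k) u * (mapCoeff P ^ k) z))) := by
      intro k
      rw [map_add, hXP, map_sum, mul_add, smul_add, mul_add]
      congr 1
      · rw [Finset.mul_sum, Finset.smul_sum, Finset.mul_sum]
        refine Finset.sum_congr rfl fun l _ => ?_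
        rw [hXP, map_smul, leibniz_pow_apply hP', Finset.smul_sum, Finset.mul_sum,
          Finset.mul_sum, Finset.smul_sum, Finset.mul_sum, Finset.mul_sum]
        refine Finset.sum_congr rfl fun ji hji => ?_
        have hk : ji.1 + ji.2 = k := Finset.HasAntidiagonal.mem_antidiagonal.mp hji
        subst hk
        simp only [F]
        have hcomm : (mapCoeff P ^ ji.1) ((mapCoeff Q ^ l) v) =
            (mapCoeff Q ^ l) ((mapCoeff P ^ ji.1) v) :=
          LinearMap.congr_fun (hc.pow_pow ji.1 l).eq v
        have hco : c ^ (ji.2 + l + ji.1) /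
            ((ji.2.factorial : ℂ) * (l.factorial : ℂ) * (ji.1.factorial : ℂ)) =
            c ^ (ji.1 + ji.2) / ((ji.1 + ji.2).factorial : ℂ) *
              (((ji.1 + ji.2).choose ji.1 : ℕ) : ℂ) * (c ^ l / (l.factorial : ℂ)) := by
          rw [smul_choose_eq]
          congr 1 <;> ring
        rw [hco, ← Nat.cast_smul_eq_nsmul ℂ, hcomm, pow_add (mapCoeff P) ji.2,
          add_comm ji.2 ji.1]
        simp only [Module.End.mul_apply, Algebra.smul_def, map_mul, map_natCast]
        ring
      · simp only [Algebra.smul_def]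
        ring
    simp_rw [e1]
    rw [Finset.sum_add_distrib, ← Finset.mul_sum, key, Finset.sum_comm, map_sum, map_sum]
    refine Finset.sum_congr rfl fun l _ => ?_
    rw [← Finset.mul_sum]
    have e2 : (∑ j ∈ Finset.range (n + 1), ∑ i ∈ Finset.range (n + 1),
        PowerSeries.X ^ (i + l + j) * F i l j) = PowerSeries.X ^ l *
        ∑ j ∈ Finset.range (n + 1), ∑ i ∈ Finset.range (n + 1),
          PowerSeries.X ^ (j + i) * F i l j := by
      simp only [Finset.mul_sum]
      refine Finset.sum_congr rfl fun j _ => Finset.sum_congr rfl fun i _ => ?_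
      ring
    rw [e2, PowerSeries.coeff_X_pow_mul', PowerSeries.coeff_X_pow_mul']
    split_ifs with hl
    · exact coeff_sum_antidiagonal (fun j i => F i l j) (by omega)
    · rfl
  rw [hL, hR]
  congr 1
  rw [Finset.sum_comm]
  conv_rhs => rw [Finset.sum_comm' (t' := Finset.range (n + 1)) (s' := fun _ => Finset.range (n + 1)) (by simp)]
  rw [Finset.sum_comm]
  refine Finset.sum_congr rfl fun j _ => ?_
  rw [Finset.sum_comm]

end StarProduct

section StarProduct

variable {R : Type*} [CommRing R] [Algebra ℂ R]

theorem starMul_add (c : ℂ) (P Q : R →ₗ[ℂ] R) (u v w : R⟦X⟧) :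
    starMul c P Q u (v + w) = starMul c P Q u v + starMul c P Q u w := by
  ext n
  simp [starMul, mul_add, Finset.sum_add_distrib]

theorem add_starMul (c : ℂ) (P Q : R →ₗ[ℂ] R) (u v w : R⟦X⟧) :
    starMul c P Q (u + v) w = starMul c P Q u w + starMul c P Q v w := by
  ext n
  simp [starMul, add_mul, Finset.sum_add_distrib]

theorem starMul_smul (c : ℂ) (P Q : R →ₗ[ℂ] R) (t : ℂ) (u v : R⟦X⟧) :
    starMul c P Q u (t • v) = t • starMul c P Q u v := by
  ext n
  simp [starMul, Finset.smul_sum, smul_comm t]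

theorem smul_starMul (c : ℂ) (P Q : R →ₗ[ℂ] R) (t : ℂ) (u v : R⟦X⟧) :
    starMul c P Q (t • u) v = t • starMul c P Q u v := by
  ext n
  simp [starMul, Finset.smul_sum, smul_comm t]

theorem starMul_eq_mul_left (c : ℂ) (P Q : R →ₗ[ℂ] R) (u v : R⟦X⟧) (h : mapCoeff Q u = 0) :
    starMul c P Q u v = u * v := by
  ext n
  rw [starMul, PowerSeries.coeff_mk, Finset.sum_eq_single (0, n)]
  · rw [mapCoeff_pow, mapCoeff_pow]
    simp
  · rintro ⟨k, l⟩ hkl hne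
    rcases k with _ | k
    · refine absurd ?_ hne
      have := Finset.HasAntidiagonal.mem_antidiagonal.mp hkl
      simp only [zero_add] at this
      rw [this]
    · have h0 : mapCoeff (Q ^ (k + 1)) u = 0 := by
        rw [mapCoeff_pow, pow_succ, Module.End.mul_apply, h, map_zero]
      simp only [h0]
      simp
  · intro hn
    exact absurd (Finset.HasAntidiagonal.mem_antidiagonal.mpr (zero_add n)) hn

theorem starMul_eq_mul_right (c : ℂ) (P Q : R →ₗ[ℂ] R) (u v : R⟦X⟧) (h : mapCoeff P v = 0) :
    starMul c P Q u v = u * v := by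
  ext n
  rw [starMul, PowerSeries.coeff_mk, Finset.sum_eq_single (0, n)]
  · rw [mapCoeff_pow, mapCoeff_pow]
    simp
  · rintro ⟨k, l⟩ hkl hne
    rcases k with _ | k
    · refine absurd ?_ hne
      have := Finset.HasAntidiagonal.mem_antidiagonal.mp hkl
      simp only [zero_add] at this
      rw [this]
    · have h0 : mapCoeff (P ^ (k + 1)) v = 0 := by
        rw [mapCoeff_pow, pow_succ, Module.End.mul_apply, h, map_zero]
      simp only [h0]
      simp
  · intro hn
    exact absurd (Finset.HasAntidiagonal.mem_antidiagonal.mpr (zero_add n)) hn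

theorem mapCoeff_one {d : R →ₗ[ℂ] R} (hd : ∀ a b, d (a * b) = d a * b + a * d b) :
    mapCoeff d (1 : R⟦X⟧) = 0 := by
  have h := mapCoeff_mul hd 1 1
  simpa using h

end StarProduct

/-- The Heisenberg algebra of the strip `(a, b) × ℝ`: its elements are the formal series
`∑ₜ εᵗ uₜ`, where `uₜ` is a finite sum of terms `f(p) g(q)` with `f ∈ C^ω(a, b)` and
`g ∈ C^ω(ℝ)`, written with `p` to the left of `q`; the product is determined by
`g(q) f(p) = ∑ₖ (iε)ᵏ/k! f^{(k)}(p) g^{(k)}(q)`, that is, by `[q, p] = iε`. -/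
@[ext]
structure Heis (a b : EReal) : Type where
  /-- The normal ordered formal series of an element. -/
  symb : (Symb a b)⟦X⟧

namespace Heis

variable {a b : EReal}

theorem symb_injective : Function.Injective (symb : Heis a b → (Symb a b)⟦X⟧) :=
  fun _ _ h => Heis.ext h

noncomputable instance : Zero (Heis a b) := ⟨⟨0⟩⟩

noncomputable instance : One (Heis a b) := ⟨⟨1⟩⟩

noncomputable instance : Add (Heis a b) := ⟨fun u v => ⟨u.symb + v.symb⟩⟩

noncomputable instance : Neg (Heis a b) := ⟨fun u => ⟨-u.symb⟩⟩

noncomputable instance : Sub (Heis a b) := ⟨fun u v => ⟨u.symb - v.symb⟩⟩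

noncomputable instance : SMul ℕ (Heis a b) := ⟨fun n u => ⟨n • u.symb⟩⟩

noncomputable instance : SMul ℤ (Heis a b) := ⟨fun n u => ⟨n • u.symb⟩⟩

noncomputable instance : SMul ℂ (Heis a b) := ⟨fun t u => ⟨t • u.symb⟩⟩

noncomputable instance : Mul (Heis a b) :=
  ⟨fun u v => ⟨starMul Complex.I (dP a b) (dQ a b) u.symb v.symb⟩⟩

noncomputable instance : AddCommGroup (Heis a b) :=
  symb_injective.addCommGroup _ rfl (fun _ _ => rfl) (fun _ => rfl) (fun _ _ => rfl)
    (fun _ _ => rfl) (fun _ _ => rfl)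

/-- The additive bijection with formal series. -/
noncomputable def symbHom : Heis a b →+ (Symb a b)⟦X⟧ where
  toFun := symb
  map_zero' := rfl
  map_add' _ _ := rfl

noncomputable instance : Module ℂ (Heis a b) :=
  Function.Injective.module ℂ symbHom symb_injective (fun _ _ => rfl)

noncomputable instance : Ring (Heis a b) :=
  { (inferInstance : AddCommGroup (Heis a b)) with
    left_distrib := fun _ _ _ => Heis.ext (starMul_add _ _ _ _ _ _)
    right_distrib := fun _ _ _ => Heis.ext (add_starMul _ _ _ _ _ _)
    zero_mul := fun u => by
      have h := smul_starMul Complex.I (dP a b) (dQ a b) 0 0 u.symb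
      rw [zero_smul, zero_smul] at h
      exact Heis.ext h
    mul_zero := fun u => by
      have h := starMul_smul Complex.I (dP a b) (dQ a b) 0 u.symb 0
      rw [zero_smul, zero_smul] at h
      exact Heis.ext h
    mul_assoc := fun _ _ _ => Heis.ext (starMul_assoc _ dP_mul dQ_mul (dP_dQ_comm a b) _ _ _)
    one_mul := fun u => Heis.ext
      ((starMul_eq_mul_left _ _ _ 1 u.symb (mapCoeff_one dQ_mul)).trans (one_mul _))
    mul_one := fun u => Heis.ext
      ((starMul_eq_mul_right _ _ _ u.symb 1 (mapCoeff_one dP_mul)).trans (mul_one _)) }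

noncomputable instance : Algebra ℂ (Heis a b) :=
  Algebra.ofModule (fun t u v => Heis.ext (smul_starMul _ _ _ t u.symb v.symb))
    (fun t u v => Heis.ext (starMul_smul _ _ _ t u.symb v.symb))

/-- The central element `ε`. -/
noncomputable def eps (a b : EReal) : Heis a b := ⟨PowerSeries.X⟩

/-- The element `F(p, ε) = ∑ εⁿ Fₙ(p)`. -/
noncomputable def ofP (F : (AnFun a b)⟦X⟧) : Heis a b :=
  ⟨PowerSeries.map (Symb.ofP a b).toRingHom F⟩

/-- The element `g(q)`. -/
noncomputable def ofQ (g : AnFun ⊥ ⊤) : Heis a b :=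
  ⟨PowerSeries.C (Symb.tmul 1 g)⟩

/-- The generator `p`. -/
noncomputable def p (a b : EReal) : Heis a b := ofP (PowerSeries.C (AnFun.coord a b))

/-- The generator `q`. -/
noncomputable def q (a b : EReal) : Heis a b := ofQ (AnFun.coord ⊥ ⊤)

/-- Setting `ε = 0`: the homomorphism onto the commutative algebra of classical functions,
whose kernel is the ideal generated by `ε`. -/
noncomputable def classical (a b : EReal) : Heis a b →ₐ[ℂ] Symb a b :=
  AlgHom.ofLinearMap
    { toFun := fun u => PowerSeries.coeff 0 u.symb
      map_add' := fun _ _ => map_add _ _ _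
      map_smul' := fun _ _ => rfl }
    PowerSeries.coeff_zero_one
    (fun u v => by
      change PowerSeries.coeff 0 (starMul Complex.I (dP a b) (dQ a b) u.symb v.symb) =
        PowerSeries.coeff 0 u.symb * PowerSeries.coeff 0 v.symb
      simp [starMul, mapCoeff, PowerSeries.coeff_mul])

theorem eps_mul (u : Heis a b) : eps a b * u = ⟨PowerSeries.X * u.symb⟩ := by
  refine Heis.ext (starMul_eq_mul_left _ _ _ _ _ ?_)
  have h := mapCoeff_X_pow_mul (dQ a b) 1 1
  rw [mapCoeff_one dQ_mul, pow_one, mul_one, mul_zero] at h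
  exact h

theorem mul_eps (u : Heis a b) : u * eps a b = ⟨u.symb * PowerSeries.X⟩ := by
  refine Heis.ext (starMul_eq_mul_right _ _ _ _ _ ?_)
  have h := mapCoeff_X_pow_mul (dP a b) 1 1
  rw [mapCoeff_one dP_mul, pow_one, mul_one, mul_zero] at h
  exact h

theorem eps_central (u : Heis a b) : eps a b * u = u * eps a b := by
  rw [eps_mul, mul_eps, mul_comm]

theorem classical_eps : classical a b (eps a b) = 0 := PowerSeries.coeff_zero_X

theorem classical_eq_zero_iff (u : Heis a b) :
    classical a b u = 0 ↔ ∃ v, u = eps a b * v := by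
  constructor
  · intro h
    obtain ⟨s, hs⟩ := (PowerSeries.X_dvd_iff (φ := u.symb)).mpr
      (by rw [← PowerSeries.coeff_zero_eq_constantCoeff_apply]; exact h)
    exact ⟨⟨s⟩, by rw [eps_mul]; exact Heis.ext hs⟩
  · rintro ⟨v, rfl⟩
    rw [map_mul, classical_eps, zero_mul]

end Heis

/-! ### Wick ordering -/

/-- The sum of all distinct words consisting of `m` letters `x` and `n` letters `y`, divided by
the number `(m + n)!/(m! n!)` of these words. -/
noncomputable def symAverage {A : Type*} [Ring A] [Algebra ℂ A] (x y : A) (m n : ℕ) : A :=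
  (((m + n).choose m : ℕ) : ℂ)⁻¹ •
    ∑ w : Fin (m + n) → Bool with (Finset.univ.filter fun i => w i = true).card = m,
      (List.ofFn fun i => if w i = true then x else y).prod

/-- Wick ordering: on polynomials in `p, q` it is symmetrisation, and it is extended to analytic
functions by requiring every coefficient of its `ε`-expansion to be a differential operator. -/
structure IsWickOrdering {a b : EReal} (Ω : Symb a b →ₗ[ℂ] Heis a b) : Prop where
  monomial : ∀ m n : ℕ, Ω (Symb.tmul (AnFun.coord a b ^ m) (AnFun.coord ⊥ ⊤ ^ n)) =
    symAverage (Heis.p a b) (Heis.q a b) m n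
  differential : ∀ n : ℕ, ∃ (s : Finset (ℕ × ℕ)) (c : ℕ × ℕ → Symb a b), ∀ u : Symb a b,
    PowerSeries.coeff n (Ω u).symb =
      ∑ j ∈ s, c j * (dP a b ^ j.1) ((dQ a b ^ j.2) u)

/-! ### Noncommutative surfaces of rotation -/

/-- The generators `X₊`, `X₋` and `F(X₀, ε) = ∑ εⁿ Fₙ(X₀)` with `Fₙ ∈ C^ω(a, b)`. -/
inductive SurfGen (a b : EReal) : Type
  | plus : SurfGen a b
  | minus : SurfGen a b
  | fn (F : (AnFun a b)⟦X⟧) : SurfGen a b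

namespace SurfGen

variable {a b : EReal}

/-- `X₊` in the free algebra. -/
noncomputable abbrev xp : FreeAlgebra ℂ (SurfGen a b) := FreeAlgebra.ι ℂ plus

/-- `X₋` in the free algebra. -/
noncomputable abbrev xm : FreeAlgebra ℂ (SurfGen a b) := FreeAlgebra.ι ℂ minus

/-- `F(X₀, ε)` in the free algebra. -/
noncomputable abbrev x0 (F : (AnFun a b)⟦X⟧) : FreeAlgebra ℂ (SurfGen a b) :=
  FreeAlgebra.ι ℂ (fn F)

end SurfGen

open SurfGen in
/-- The relations of the noncommutative surface of rotation with profile `ρ(z, ε)`. The first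
three make `F ↦ F(X₀, ε)` an algebra homomorphism. The next two, `F(X₀, ε) X₊ = X₊ F(X₀ + ε, ε)`
and `F(X₀, ε) X₋ = X₋ F(X₀ - ε, ε)`, contain `[X₀, X₊] = ε X₊` and `[X₀, X₋] = -ε X₋` and the
centrality of `ε`. -/
inductive SurfRel {a b : EReal} (ρ : (AnFun a b)⟦X⟧) :
    FreeAlgebra ℂ (SurfGen a b) → FreeAlgebra ℂ (SurfGen a b) → Prop
  | add (F G : (AnFun a b)⟦X⟧) : SurfRel ρ (x0 (F + G)) (x0 F + x0 G)
  | mul (F G : (AnFun a b)⟦X⟧) : SurfRel ρ (x0 (F * G)) (x0 F * x0 G)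
  | const (c : ℂ) : SurfRel ρ (x0 (algebraMap ℂ _ c)) (algebraMap ℂ _ c)
  | fn_plus (F : (AnFun a b)⟦X⟧) : SurfRel ρ (x0 F * xp) (xp * x0 (epsShift 1 F))
  | fn_minus (F : (AnFun a b)⟦X⟧) : SurfRel ρ (x0 F * xm) (xm * x0 (epsShift (-1) F))
  | commutator : SurfRel ρ (xp * xm - xm * xp)
      (x0 (epsShift (-(1 / 2)) ρ) - x0 (epsShift (1 / 2) ρ))
  | anticommutator : SurfRel ρ (xp * xm + xm * xp)
      (x0 (epsShift (-(1 / 2)) ρ) + x0 (epsShift (1 / 2) ρ))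

/-- The noncommutative surface of rotation, enlarged by functions analytic in `X₀`: its elements
are the finite sums of `X₊ʳ F_r(X₀, ε)` and `X₋ʳ F_{-r}(X₀, ε)`. -/
abbrev SurfAlg {a b : EReal} (ρ : (AnFun a b)⟦X⟧) : Type := RingQuot (SurfRel ρ)

namespace SurfAlg

variable {a b : EReal} (ρ : (AnFun a b)⟦X⟧)

/-- The generator `X₊`. -/
noncomputable def plus : SurfAlg ρ := RingQuot.mkAlgHom ℂ (SurfRel ρ) SurfGen.xp

/-- The generator `X₋`. -/
noncomputable def minus : SurfAlg ρ := RingQuot.mkAlgHom ℂ (SurfRel ρ) SurfGen.xm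

/-- The element `F(X₀, ε)`. -/
noncomputable def fn (F : (AnFun a b)⟦X⟧) : SurfAlg ρ :=
  RingQuot.mkAlgHom ℂ (SurfRel ρ) (SurfGen.x0 F)

/-- The central element `ε`. -/
noncomputable def eps : SurfAlg ρ := fn ρ PowerSeries.X

/-- The commutative algebra `A⁰` obtained from the surface by setting `ε = 0`. -/
abbrev Classical : Type := RingQuot fun x y : SurfAlg ρ => x = eps ρ ∧ y = 0

/-- The quotient map `π : A → A⁰`. -/
noncomputable def toClassical : SurfAlg ρ →ₐ[ℂ] Classical ρ := RingQuot.mkAlgHom ℂ _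

end SurfAlg

section Orderings

variable {a b : EReal} {ρ : (AnFun a b)⟦X⟧}

/-- The Heisenberg coordinate homomorphism: `Ψ(ε) = ε`, `Ψ(F(X₀, ε)) = F(p, ε)` and
`Ψ(X_±) = e^{±iq} √ρ(p ± ε/2, ε)`. -/
structure IsHeisenbergCoord (Ψ : SurfAlg ρ →ₐ[ℂ] Heis a b) : Prop where
  map_eps : Ψ (SurfAlg.eps ρ) = Heis.eps a b
  map_fn : ∀ F, Ψ (SurfAlg.fn ρ F) = Heis.ofP F
  map_plus : ∃ s, IsPosSqrt s (epsShift (1 / 2) ρ) ∧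
    Ψ (SurfAlg.plus ρ) = Heis.ofQ (expFun 1) * Heis.ofP s
  map_minus : ∃ s, IsPosSqrt s (epsShift (-(1 / 2)) ρ) ∧
    Ψ (SurfAlg.minus ρ) = Heis.ofQ (expFun (-1)) * Heis.ofP s

/-- The homomorphism `Ψ⁰` of the commutative algebras induced by `Ψ`: the one with
`Ψ⁰ ∘ π = π ∘ Ψ`. -/
noncomputable def IsHeisenbergCoord.classical {Ψ : SurfAlg ρ →ₐ[ℂ] Heis a b}
    (h : IsHeisenbergCoord Ψ) : SurfAlg.Classical ρ →ₐ[ℂ] Symb a b :=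
  RingQuot.liftAlgHom ℂ ⟨(Heis.classical a b).comp Ψ, by
    rintro x y ⟨rfl, rfl⟩
    simp [h.map_eps, Heis.classical_eps]⟩

theorem IsHeisenbergCoord.classical_toClassical {Ψ : SurfAlg ρ →ₐ[ℂ] Heis a b}
    (h : IsHeisenbergCoord Ψ) (x : SurfAlg ρ) :
    h.classical (SurfAlg.toClassical ρ x) = Heis.classical a b (Ψ x) :=
  RingQuot.liftAlgHom_mkAlgHom_apply ℂ _ _ x

/-- An ordering: an injective linear section `Ω` of `π` with `Ω(1) = 1`. -/
structure IsOrdering (Ω : SurfAlg.Classical ρ →ₗ[ℂ] SurfAlg ρ) : Prop where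
  injective : Function.Injective Ω
  toClassical_apply : ∀ u, SurfAlg.toClassical ρ (Ω u) = u
  map_one : Ω 1 = 1

/-- The central ordering: if `Ψ⁰(u) = e^{irq} f(p)`, then `Ω(u)` is the element with
`Ψ(Ω(u)) = e^{irq} f(p + rε/2)`. -/
def IsCentralOrdering {Ψ : SurfAlg ρ →ₐ[ℂ] Heis a b} (h : IsHeisenbergCoord Ψ)
    (Ω : SurfAlg.Classical ρ →ₗ[ℂ] SurfAlg ρ) : Prop :=
  ∀ (u : SurfAlg.Classical ρ) (r : ℤ) (f : AnFun a b),
    h.classical u = Symb.tmul f (expFun r) →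
      Ψ (Ω u) = Heis.ofQ (expFun r) * Heis.ofP (epsShift ((r : ℂ) / 2) (PowerSeries.C f))

/-- `x = ∑ₖ εᵏ Ω(Cₖ)`, as an expansion in powers of `ε`. -/
def IsEpsExpansion (Ω : SurfAlg.Classical ρ →ₗ[ℂ] SurfAlg ρ) (x : SurfAlg ρ)
    (C : ℕ → SurfAlg.Classical ρ) : Prop :=
  ∀ N : ℕ, ∃ y : SurfAlg ρ,
    x = ∑ k ∈ Finset.range N, SurfAlg.eps ρ ^ k * Ω (C k) + SurfAlg.eps ρ ^ N * y

/-- The star product of the ordering `Ω`: `u ⋆ v = ∑ₖ εᵏ Cₖ`, where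
`Ω(u) Ω(v) = ∑ₖ εᵏ Ω(Cₖ)`. -/
def IsStarProduct (Ω : SurfAlg.Classical ρ →ₗ[ℂ] SurfAlg ρ) (u v : SurfAlg.Classical ρ)
    (C : ℕ → SurfAlg.Classical ρ) : Prop :=
  IsEpsExpansion Ω (Ω u * Ω v) C

end Orderings

/-! ### The Vey product -/

/-- The bidifferential operator `P = ∂₁/∂q ∂₂/∂p - ∂₁/∂p ∂₂/∂q`, acting on pairs of functions. -/
noncomputable def biP (a b : EReal) :
    Symb a b ⊗[ℂ] Symb a b →ₗ[ℂ] Symb a b ⊗[ℂ] Symb a b :=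
  TensorProduct.map (dQ a b) (dP a b) - TensorProduct.map (dP a b) (dQ a b)

/-- `Pᵏ(u, v)`. -/
noncomputable def biPow {a b : EReal} (k : ℕ) (u v : Symb a b) : Symb a b :=
  LinearMap.mul' ℂ (Symb a b) ((biP a b ^ k) (u ⊗ₜ v))

/-- The coefficient `(iP/2)ᵏ/k! (u, v)` of `εᵏ` in the Vey product `exp(iεP/2)(u, v)`. -/
noncomputable def veyCoeff {a b : EReal} (k : ℕ) (u v : Symb a b) : Symb a b :=
  ((Complex.I / 2) ^ k / (k.factorial : ℂ)) • biPow k u v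

/-! Everything is computed in the Heisenberg algebra, in the normal form with `p` to the left of
`q`.

Two formulas carry the proof. The first concerns exponentials: `e^{icq}` is an eigenvector of
`∂/∂q`, so the star product with a function of `p` collapses to a Taylor series, `e^{icq} F(p) = F(p
- cε) e^{icq}` (`Heis.ofQ_expC_mul_ofP`). Hence the shift `F(z, ε) ↦ F(z + cε, ε)` is conjugation by
an exponential, and its algebraic properties follow from this.

The second is Moyal's formula. Wick ordering is `exp(iε/2 ∂p∂q)`. A product of two Wick ordered
symbols is obtained from `u ⊗ v` by applying an exponential of commuting operators and multiplying;
the exponent equals `(i/2)P` plus the operator that Wick ordering becomes on a product by the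
Leibniz rule (`moyal_operator_eq`). So the product is the Wick ordering of `exp(iεP/2)(u, v)`
(`coeff_wick_mul_wick`). Multiplying by a single `p` or `q` is a special case, and an induction on
word length identifies this exponential with symmetrisation. It is the only Wick ordering, because a
differential operator that kills all monomials has zero coefficients.

On the surface, the two relations between `X₊` and `X₋` amount to `X₊X₋ = ρ(X₀ - ε/2)` and `X₋X₊ =
ρ(X₀ + ε/2)`. A positive square root `σ` of `ρ` is a unit, so `E = X₊ σ(X₀ + ε/2)⁻¹` is a unit, and
every element is a finite sum of `F_r(X₀, ε) Eʳ`. Since `Ψ(Eʳ) = e^{irq}` and these exponentials are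
linearly independent, `Ψ` is injective. The same argument shows that if the coefficients of `Ψ(x)`
below order `N` vanish, then `x` is divisible by `ε^N` inside the surface
(`IsHeisenbergCoord.exists_eps_pow_mul`); `N = 1` gives the injectivity of `Ψ⁰`.

Finally, the image of `Ψ⁰` is the space of finite sums of `f(p) e^{irq}`. There Wick ordering is
exactly `f(p) e^{irq} ↦ e^{irq} f(p + rε/2)`, so the central ordering is characterised by `Ψ ∘ Ω_C =
Ω_W ∘ Ψ⁰` (`isCentralOrdering_iff`). Moyal's formula is then pulled back through the injective maps
`Ψ` and `Ψ⁰`. -/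

section

variable {a b : EReal}

/-! ### Divided powers of operators -/

/-- The divided power `xⁿ/n!`. -/
noncomputable def divPow {A : Type*} [Ring A] [Algebra ℂ A] (x : A) (n : ℕ) : A :=
  (n.factorial : ℂ)⁻¹ • x ^ n

section DivPow

variable {A : Type*} [Ring A] [Algebra ℂ A]

theorem divPow_zero (x : A) : divPow x 0 = 1 := by simp [divPow]

theorem divPow_smul (c : ℂ) (x : A) (n : ℕ) :
    divPow (c • x) n = (c ^ n / (n.factorial : ℂ)) • x ^ n := by
  rw [divPow, smul_pow, smul_smul, div_eq_inv_mul]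

/-- The binomial theorem divided by `n!`: these are the coefficients of `exp(x + y) = exp(x)
exp(y)`. It lets formal exponentials of operators be split and recombined. -/
theorem divPow_add {x y : A} (h : Commute x y) (n : ℕ) :
    divPow (x + y) n =
      ∑ ij ∈ Finset.HasAntidiagonal.antidiagonal n, divPow x ij.1 * divPow y ij.2 := by
  rw [divPow, h.add_pow', Finset.smul_sum]
  refine Finset.sum_congr rfl fun ij hij => ?_
  have hn : ij.1 + ij.2 = n := Finset.HasAntidiagonal.mem_antidiagonal.mp hij
  subst hn
  have h1 : ((ij.1 + ij.2).factorial : ℂ) ≠ 0 := by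
    exact_mod_cast (ij.1 + ij.2).factorial_ne_zero
  have h2 : (ij.1.factorial : ℂ) ≠ 0 := by exact_mod_cast ij.1.factorial_ne_zero
  have h3 : (ij.2.factorial : ℂ) ≠ 0 := by exact_mod_cast ij.2.factorial_ne_zero
  have h4 : (((ij.1 + ij.2).choose ij.1 : ℕ) : ℂ) * ij.1.factorial * ij.2.factorial =
      (ij.1 + ij.2).factorial := by
    rw [Nat.choose_symm_add]
    exact_mod_cast Nat.add_choose_mul_factorial_mul_factorial ij.1 ij.2
  rw [divPow, divPow, smul_mul_smul_comm, ← Nat.cast_smul_eq_nsmul ℂ, smul_smul]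
  congr 1
  field_simp
  linear_combination h4

theorem Commute.divPow_divPow {x y : A} (h : Commute x y) (m n : ℕ) :
    Commute (divPow x m) (divPow y n) :=
  ((h.pow_pow m n).smul_left _).smul_right _

theorem map_divPow {B : Type*} [Ring B] [Algebra ℂ B] (f : A →ₐ[ℂ] B) (x : A) (n : ℕ) :
    f (divPow x n) = divPow (f x) n := by
  simp [divPow]

/-- An intertwiner of two operators intertwines their exponentials. It is applied to the
multiplication map and to `g ↦ g(p) e^{irq}`. -/
theorem divPow_semiconj {M N : Type*} [AddCommGroup M] [Module ℂ M] [AddCommGroup N] [Module ℂ N]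
    {f : M →ₗ[ℂ] N} {D : Module.End ℂ M} {E : Module.End ℂ N} (h : ∀ u, E (f u) = f (D u))
    (n : ℕ) (u : M) : divPow E n (f u) = f (divPow D n u) := by
  have h1 : ∀ u, (E ^ n) (f u) = f ((D ^ n) u) := by
    intro u
    induction n generalizing u with
    | zero => simp
    | succ n ih => rw [pow_succ, pow_succ, Module.End.mul_apply, Module.End.mul_apply, h, ih]
  simp only [divPow, LinearMap.smul_apply, h1, map_smul]

end DivPow

/-! ### Exponential functions of `q` -/

/-- The function `q ↦ e^{icq}` with a complex parameter `c`. -/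
noncomputable def expC (c : ℂ) : AnFun ⊥ ⊤ :=
  AnFun.of (fun t : ℝ => Complex.exp (Complex.I * c * t)) fun t _ => by
    have h : AnalyticAt ℝ (fun t : ℝ => Complex.I * c * (t : ℂ)) t :=
      analyticAt_const.mul (Complex.ofRealCLM.analyticAt t)
    exact (analyticAt_cexp.restrictScalars (𝕜 := ℝ)).comp h

theorem expFun_eq (r : ℤ) : expFun r = expC r := rfl

theorem expC_apply (c : ℂ) (t : realIoo ⊥ ⊤) :
    (expC c).1 t = Complex.exp (Complex.I * c * (t : ℝ)) := rfl

theorem expC_zero : expC 0 = 1 := by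
  ext t
  rw [expC_apply]
  simp

theorem expC_add (c d : ℂ) : expC (c + d) = expC c * expC d := by
  ext t
  change (expC (c + d)).1 t = (expC c).1 t * (expC d).1 t
  rw [expC_apply, expC_apply, expC_apply, ← Complex.exp_add]
  ring_nf

theorem AnFun.deriv_apply {a b : EReal} (f : AnFun a b) {F F' : ℝ → ℂ} (hf : ∀ z, f.1 z = F z)
    (h : ∀ t, HasDerivAt F (F' t) t) (z : realIoo a b) : (AnFun.deriv f).1 z = F' z :=
  (extZero_eventuallyEq hf z.2).deriv_eq.trans (h z).deriv

theorem deriv_expC (c : ℂ) : AnFun.deriv (expC c) = (Complex.I * c) • expC c := by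
  ext z
  refine AnFun.deriv_apply _ (F := fun t => Complex.exp (Complex.I * c * t))
    (F' := fun t => Complex.I * c * Complex.exp (Complex.I * c * t)) (fun _ => rfl) (fun t => ?_) z
  have h : HasDerivAt (fun t : ℝ => Complex.I * c * (t : ℂ)) (Complex.I * c) t := by
    simpa using (Complex.ofRealCLM.hasDerivAt (x := t)).const_mul (Complex.I * c)
  simpa [mul_comm] using h.cexp

theorem deriv_coord (a b : EReal) : AnFun.deriv (AnFun.coord a b) = 1 := by
  ext z
  refine AnFun.deriv_apply _ (F := fun t => (t : ℂ)) (F' := fun _ => 1) (fun _ => rfl)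
    (fun t => ?_) z
  exact (Complex.ofRealCLM.hasDerivAt (x := t)).congr_deriv (by simp)

/-- Dedekind's independence of characters, for the additive group of real numbers. The characters
are distinct because their derivatives at `0` are `ir`. -/
theorem linearIndependent_expFun : LinearIndependent ℂ expFun := by
  let χ : ℤ → (Multiplicative ℝ →* ℂ) := fun r =>
    { toFun := fun t => Complex.exp (Complex.I * r * (Multiplicative.toAdd t : ℝ))
      map_one' := by simp
      map_mul' := fun s t => by
        rw [← Complex.exp_add, toAdd_mul]
        push_cast
        ring_nf }
  have hχ : Function.Injective χ := by
    intro r s h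
    have h1 : ∀ n : ℤ, HasDerivAt (fun t : ℝ => Complex.exp (Complex.I * n * (t : ℂ)))
        (Complex.I * n) 0 := by
      intro n
      have h : HasDerivAt (fun t : ℝ => Complex.I * n * (t : ℂ)) (Complex.I * n) 0 := by
        simpa using (Complex.ofRealCLM.hasDerivAt (x := 0)).const_mul (Complex.I * n)
      simpa using h.cexp
    have h2 : (fun t : ℝ => Complex.exp (Complex.I * r * (t : ℂ))) =
        fun t : ℝ => Complex.exp (Complex.I * s * (t : ℂ)) :=
      funext fun t => DFunLike.congr_fun h (Multiplicative.ofAdd t)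
    have h3 := (h1 r).unique (h2 ▸ h1 s)
    exact_mod_cast mul_left_cancel₀ Complex.I_ne_zero h3
  have hli := (linearIndependent_monoidHom (Multiplicative ℝ) ℂ).comp χ hχ
  let ev : AnFun ⊥ ⊤ →ₗ[ℂ] (Multiplicative ℝ → ℂ) :=
    { toFun := fun f t => f.1 ⟨Multiplicative.toAdd t, EReal.bot_lt_coe _, EReal.coe_lt_top _⟩
      map_add' := fun _ _ => rfl
      map_smul' := fun _ _ => rfl }
  exact LinearIndependent.of_comp ev hli

/-- The coordinate functional on the span of the exponentials, extended arbitrarily to all analytic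
functions. -/
theorem exists_dual_expFun (r : ℤ) :
    ∃ φ : AnFun ⊥ ⊤ →ₗ[ℂ] ℂ, ∀ s, φ (expFun s) = if s = r then 1 else 0 := by
  obtain ⟨φ, hφ⟩ := LinearMap.exists_extend
    ((Finsupp.lapply r) ∘ₗ linearIndependent_expFun.repr)
  refine ⟨φ, fun s => ?_⟩
  have h := LinearMap.congr_fun hφ
    ⟨expFun s, Submodule.subset_span (Set.mem_range_self s)⟩
  rw [LinearMap.comp_apply] at h
  refine h.trans ?_
  rw [LinearMap.comp_apply, linearIndependent_expFun.repr_eq_single s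
    ⟨expFun s, Submodule.subset_span (Set.mem_range_self s)⟩ rfl, Finsupp.lapply_apply,
    Finsupp.single_apply]

/-- Contracting the second tensor factor with the dual functional reads off the Fourier coefficient
of `e^{irq}`. -/
theorem exists_coeff_expFun (a b : EReal) (r : ℤ) :
    ∃ φ : Symb a b →ₗ[ℂ] AnFun a b, ∀ f s, φ (Symb.tmul f (expFun s)) = if s = r then f else 0 := by
  obtain ⟨φ, hφ⟩ := exists_dual_expFun r
  refine ⟨(TensorProduct.rid ℂ (AnFun a b)).toLinearMap ∘ₗ LinearMap.lTensor _ φ ∘ₗ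
    (Symb.toTensor a b).toLinearMap, fun f s => ?_⟩
  rw [LinearMap.comp_apply, LinearMap.comp_apply, AlgEquiv.toLinearMap_apply, Symb.toTensor_tmul,
    LinearMap.lTensor_tmul, hφ, LinearEquiv.coe_coe, TensorProduct.rid_tmul]
  split_ifs <;> simp

/-! ### Calculations in the Heisenberg algebra -/

namespace Symb

theorem one_def : (1 : Symb a b) = tmul 1 1 := rfl

theorem smul_tmul' (c : ℂ) (f : AnFun a b) (g : AnFun ⊥ ⊤) :
    tmul (c • f) g = c • tmul f g := (TensorProduct.smul_tmul' c f g).symm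

theorem tmul_smul (c : ℂ) (f : AnFun a b) (g : AnFun ⊥ ⊤) :
    tmul f (c • g) = c • tmul f g := TensorProduct.tmul_smul c f g

end Symb

theorem dP_pow_tmul (k : ℕ) (f : AnFun a b) (g : AnFun ⊥ ⊤) :
    (dP a b ^ k) (Symb.tmul f g) =
      Symb.tmul (((AnFun.deriv (a := a) (b := b) : AnFun a b →ₗ[ℂ] AnFun a b) ^ k) f) g := by
  induction k generalizing f with
  | zero => rfl
  | succ k ih => rw [pow_succ, pow_succ, Module.End.mul_apply, Module.End.mul_apply, dP_tmul, ih]; rfl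

theorem dQ_tmul_expC (f : AnFun a b) (c : ℂ) :
    dQ a b (Symb.tmul f (expC c)) = (Complex.I * c) • Symb.tmul f (expC c) := by
  rw [dQ_tmul, deriv_expC, Symb.tmul_smul]

theorem dQ_pow_tmul_expC (k : ℕ) (f : AnFun a b) (c : ℂ) :
    (dQ a b ^ k) (Symb.tmul f (expC c)) = (Complex.I * c) ^ k • Symb.tmul f (expC c) := by
  induction k with
  | zero => simp
  | succ k ih => rw [pow_succ', Module.End.mul_apply, ih, map_smul, dQ_tmul_expC, smul_smul, pow_succ]

theorem coeff_mapCoeff {R : Type*} [CommRing R] [Algebra ℂ R] (d : R →ₗ[ℂ] R) (u : R⟦X⟧) (n : ℕ) :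
    PowerSeries.coeff n (mapCoeff d u) = d (PowerSeries.coeff n u) := by simp [mapCoeff]

theorem mapCoeff_C {R : Type*} [CommRing R] [Algebra ℂ R] (d : R →ₗ[ℂ] R) (u : R) :
    mapCoeff d (PowerSeries.C u) = PowerSeries.C (d u) := by
  ext n
  simp only [mapCoeff, LinearMap.coe_mk, AddHom.coe_mk, PowerSeries.coeff_mk, PowerSeries.coeff_C]
  split_ifs <;> simp

namespace Heis

theorem coeff_ofP (F : (AnFun a b)⟦X⟧) (n : ℕ) :
    PowerSeries.coeff n (ofP F).symb = Symb.tmul (PowerSeries.coeff n F) 1 :=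
  PowerSeries.coeff_map _ n F

theorem mul_symb (u v : Heis a b) :
    (u * v).symb = starMul Complex.I (dP a b) (dQ a b) u.symb v.symb := rfl

/-- A left factor in `p` alone is killed by `∂/∂q`, so only the zeroth term of the star product
remains. The next lemma is the mirror case. -/
theorem ofP_mul (F : (AnFun a b)⟦X⟧) (u : Heis a b) :
    (ofP F * u).symb = (ofP F).symb * u.symb := by
  refine starMul_eq_mul_left _ _ _ _ _ ?_
  ext n
  rw [coeff_mapCoeff, coeff_ofP, dQ_tmul, Derivation.map_one_eq_zero, map_zero]
  exact TensorProduct.tmul_zero _ _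

theorem mul_ofQ (u : Heis a b) (g : AnFun ⊥ ⊤) :
    (u * ofQ g).symb = u.symb * PowerSeries.C (Symb.tmul 1 g) := by
  refine starMul_eq_mul_right _ _ _ _ _ ?_
  change mapCoeff (dP a b) (PowerSeries.C (Symb.tmul 1 g)) = 0
  have h : Symb.tmul (0 : AnFun a b) g = 0 := TensorProduct.zero_tmul _ _
  rw [mapCoeff_C, dP_tmul, Derivation.map_one_eq_zero, h, map_zero]

theorem coeff_ofP_mul_ofQ (F : (AnFun a b)⟦X⟧) (g : AnFun ⊥ ⊤) (n : ℕ) :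
    PowerSeries.coeff n (ofP F * ofQ g).symb = Symb.tmul (PowerSeries.coeff n F) g := by
  rw [mul_ofQ, PowerSeries.coeff_mul_C, coeff_ofP, Symb.tmul_mul_tmul, mul_one, one_mul]

/-- `F ↦ F(p, ε)` as a homomorphism. -/
noncomputable def ofPHom (a b : EReal) : (AnFun a b)⟦X⟧ →ₐ[ℂ] Heis a b :=
  AlgHom.ofLinearMap
    { toFun := ofP
      map_add' := fun F G => Heis.ext (map_add (PowerSeries.map (Symb.ofP a b).toRingHom) F G)
      map_smul' := fun c F => Heis.ext <| by
        ext n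
        change PowerSeries.coeff n (ofP (c • F)).symb = c • PowerSeries.coeff n (ofP F).symb
        rw [coeff_ofP, coeff_ofP, ← Symb.smul_tmul']
        rfl }
    (Heis.ext (map_one (PowerSeries.map (Symb.ofP a b).toRingHom)))
    (fun F G => Heis.ext <| by
      rw [LinearMap.coe_mk, AddHom.coe_mk, ofP_mul]
      exact map_mul (PowerSeries.map (Symb.ofP a b).toRingHom) F G)

theorem ofPHom_apply (F : (AnFun a b)⟦X⟧) : ofPHom a b F = ofP F := rfl

theorem ofP_X : ofP (PowerSeries.X : (AnFun a b)⟦X⟧) = eps a b :=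
  Heis.ext (PowerSeries.map_X _)

/-- The constant function `1` of `q` is `e^{i0q}`, so the Fourier coefficient at `0` recovers `F`.
This allows identities between shifted series to be checked in the Heisenberg algebra. -/
theorem ofP_injective : Function.Injective (ofP : (AnFun a b)⟦X⟧ → Heis a b) := by
  intro F G h
  obtain ⟨φ, hφ⟩ := exists_coeff_expFun a b 0
  have h0 : ∀ f : AnFun a b, φ (Symb.tmul f 1) = f := fun f => by
    have h1 := hφ f 0
    rwa [if_pos rfl, expFun_eq, Int.cast_zero, expC_zero] at h1
  ext1 n
  have h2 := congrArg (fun u : Heis a b => φ (PowerSeries.coeff n u.symb)) h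
  simpa only [coeff_ofP, h0] using h2

theorem ofQ_mul (g g' : AnFun ⊥ ⊤) : (ofQ (g * g') : Heis a b) = ofQ g * ofQ g' := by
  refine Heis.ext ?_
  rw [mul_ofQ]
  change PowerSeries.C _ = PowerSeries.C _ * PowerSeries.C _
  rw [← map_mul, Symb.tmul_mul_tmul, mul_one]

theorem ofQ_one : (ofQ 1 : Heis a b) = 1 := Heis.ext (map_one PowerSeries.C)

theorem ofQ_expC_mul (c d : ℂ) :
    (ofQ (expC c) * ofQ (expC d) : Heis a b) = ofQ (expC (c + d)) := by
  rw [expC_add, ofQ_mul]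

theorem ofQ_expC_mul_neg (c : ℂ) : (ofQ (expC c) * ofQ (expC (-c)) : Heis a b) = 1 := by
  rw [ofQ_expC_mul, add_neg_cancel, expC_zero, ofQ_one]

theorem ofQ_expC_neg_mul (c : ℂ) : (ofQ (expC (-c)) * ofQ (expC c) : Heis a b) = 1 := by
  rw [ofQ_expC_mul, neg_add_cancel, expC_zero, ofQ_one]

/-- `∂/∂q` acts on `e^{icq}` as `ic`, so the `k`-th term of the star product carries the factor
`iᵏ(ic)ᵏ = (-c)ᵏ`; the sum is the Taylor series of the shift by `-cε`. -/
theorem ofQ_expC_mul_ofP (c : ℂ) (F : (AnFun a b)⟦X⟧) :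
    ofQ (expC c) * ofP F = ofP (epsShift (-c) F) * ofQ (expC c) := by
  refine Heis.ext ?_
  ext n
  rw [coeff_ofP_mul_ofQ, mul_symb, starMul, PowerSeries.coeff_mk, epsShift, PowerSeries.coeff_mk]
  change _ = (TensorProduct.mk ℂ (AnFun a b) (AnFun ⊥ ⊤)).flip (expC c) _
  rw [map_sum]
  refine Finset.sum_congr rfl fun kl _ => ?_
  rw [map_smul]
  change (Complex.I ^ kl.1 / (kl.1.factorial : ℂ)) • PowerSeries.coeff kl.2
    (mapCoeff (dQ a b ^ kl.1) (PowerSeries.C (Symb.tmul 1 (expC c))) *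
      mapCoeff (dP a b ^ kl.1) (ofP F).symb) = _ • Symb.tmul _ (expC c)
  rw [mapCoeff_C, PowerSeries.coeff_C_mul, dQ_pow_tmul_expC]
  rw [coeff_mapCoeff, coeff_ofP, dP_pow_tmul, smul_mul_assoc, Symb.tmul_mul_tmul, one_mul, mul_one, smul_smul]
  congr 1
  rw [mul_pow, div_mul_eq_mul_div, ← mul_assoc, ← mul_pow, Complex.I_mul_I, ← mul_pow, neg_one_mul]

theorem ofP_mul_ofQ_expC (c : ℂ) (F : (AnFun a b)⟦X⟧) :
    ofP F * ofQ (expC c) = ofQ (expC c) * ofP (epsShift c F) := by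
  have h := ofQ_expC_mul_ofP (-c) F
  rw [neg_neg] at h
  calc ofP F * ofQ (expC c)
      = ofQ (expC c) * (ofQ (expC (-c)) * ofP F) * ofQ (expC c) := by
        rw [← mul_assoc, ofQ_expC_mul_neg, one_mul]
    _ = _ := by rw [h, mul_assoc, mul_assoc, ofQ_expC_neg_mul, mul_one]

/-- Expressing the shift as a conjugation gives its multiplicativity and its additivity in `c`
without binomial identities. -/
theorem ofP_epsShift (c : ℂ) (F : (AnFun a b)⟦X⟧) :
    ofP (epsShift c F) = ofQ (expC (-c)) * ofPHom a b F * ofQ (expC c) := by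
  rw [ofPHom_apply, mul_assoc, ofP_mul_ofQ_expC, ← mul_assoc, ofQ_expC_neg_mul, one_mul]

end Heis

/-! ### Algebraic properties of the shift in `ε` -/

/-- The shift `F(z, ε) ↦ F(z + cε, ε)` as a homomorphism. -/
noncomputable def epsShiftHom (c : ℂ) : (AnFun a b)⟦X⟧ →ₐ[ℂ] (AnFun a b)⟦X⟧ :=
  AlgHom.ofLinearMap
    { toFun := epsShift c
      map_add' := fun F G => Heis.ofP_injective <| by
        change _ = Heis.ofPHom a b (_ + _)
        simp only [map_add, Heis.ofPHom_apply, Heis.ofP_epsShift, mul_add, add_mul]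
      map_smul' := fun t F => Heis.ofP_injective <| by
        change _ = Heis.ofPHom a b (_ • _)
        simp only [map_smul, Heis.ofPHom_apply, Heis.ofP_epsShift, mul_smul_comm, smul_mul_assoc,
          RingHom.id_apply] }
    (Heis.ofP_injective <| by
      change _ = Heis.ofPHom a b 1
      rw [LinearMap.coe_mk, AddHom.coe_mk, Heis.ofP_epsShift, map_one, mul_one,
        Heis.ofQ_expC_neg_mul])
    (fun F G => Heis.ofP_injective <| by
      change Heis.ofP (epsShift c (F * G)) = Heis.ofPHom a b (epsShift c F * epsShift c G)
      rw [Heis.ofP_epsShift, map_mul, map_mul, Heis.ofPHom_apply (epsShift c F),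
        Heis.ofPHom_apply (epsShift c G), Heis.ofP_epsShift, Heis.ofP_epsShift]
      have h := Heis.ofQ_expC_mul_neg (a := a) (b := b) c
      calc _ = Heis.ofQ (expC (-c)) * Heis.ofPHom a b F * 1 * Heis.ofPHom a b G *
            Heis.ofQ (expC c) := by
              simp only [mul_one, mul_assoc]
        _ = _ := by rw [← h]; simp only [mul_assoc])

theorem epsShiftHom_apply (c : ℂ) (F : (AnFun a b)⟦X⟧) : epsShiftHom c F = epsShift c F := rfl

theorem epsShift_epsShift (c d : ℂ) (F : (AnFun a b)⟦X⟧) :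
    epsShift c (epsShift d F) = epsShift (c + d) F := by
  refine Heis.ofP_injective ?_
  rw [Heis.ofP_epsShift, Heis.ofPHom_apply, Heis.ofP_epsShift, Heis.ofP_epsShift, neg_add,
    add_comm c d, ← Heis.ofQ_expC_mul, ← Heis.ofQ_expC_mul]
  simp only [mul_assoc]

theorem epsShift_zero (F : (AnFun a b)⟦X⟧) : epsShift 0 F = F := by
  refine Heis.ofP_injective ?_
  rw [Heis.ofP_epsShift, neg_zero, expC_zero, Heis.ofQ_one, one_mul, mul_one, Heis.ofPHom_apply]

theorem constantCoeff_epsShift (c : ℂ) (F : (AnFun a b)⟦X⟧) :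
    PowerSeries.constantCoeff (epsShift c F) = PowerSeries.constantCoeff F := by
  rw [← PowerSeries.coeff_zero_eq_constantCoeff_apply, epsShift, PowerSeries.coeff_mk]
  simp

theorem coeff_epsShift_C (c : ℂ) (f : AnFun a b) (n : ℕ) :
    PowerSeries.coeff n (epsShift c (PowerSeries.C f)) =
      divPow (c • (AnFun.deriv (a := a) (b := b) : Module.End ℂ (AnFun a b))) n f := by
  rw [epsShift, PowerSeries.coeff_mk, Finset.sum_eq_single (n, 0), divPow_smul,
    LinearMap.smul_apply]
  · simp
  · rintro ⟨k, l⟩ hkl hne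
    have hl : l ≠ 0 := by
      rintro rfl
      exact hne (by rw [← Finset.HasAntidiagonal.mem_antidiagonal.mp hkl, add_zero])
    simp [PowerSeries.coeff_C, hl]
  · intro h
    exact absurd (Finset.HasAntidiagonal.mem_antidiagonal.mpr (add_zero n)) h

/-! ### The Moyal product -/

/-- The operator `(i/2) ∂²/∂p∂q`. -/
noncomputable def mixedD (a b : EReal) : Module.End ℂ (Symb a b) :=
  (Complex.I / 2) • (dP a b * dQ a b)

/-- The Wick ordering `exp((iε/2) ∂²/∂p∂q)`. -/
noncomputable def wick (a b : EReal) : Symb a b →ₗ[ℂ] Heis a b where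
  toFun u := ⟨PowerSeries.mk fun n => divPow (mixedD a b) n u⟩
  map_add' u v := Heis.ext <| by
    ext n
    change PowerSeries.coeff n (PowerSeries.mk fun n => divPow (mixedD a b) n (u + v)) =
      PowerSeries.coeff n ((PowerSeries.mk fun n => divPow (mixedD a b) n u) +
        PowerSeries.mk fun n => divPow (mixedD a b) n v)
    simp
  map_smul' c u := Heis.ext <| by
    ext n
    change PowerSeries.coeff n (PowerSeries.mk fun n => divPow (mixedD a b) n (c • u)) =
      PowerSeries.coeff n (c • PowerSeries.mk fun n => divPow (mixedD a b) n u)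
    simp

theorem coeff_wick (u : Symb a b) (n : ℕ) :
    PowerSeries.coeff n (wick a b u).symb = divPow (mixedD a b) n u :=
  PowerSeries.coeff_mk n fun n => divPow (mixedD a b) n u

theorem veyCoeff_eq (k : ℕ) (u v : Symb a b) :
    veyCoeff k u v =
      LinearMap.mul' ℂ (Symb a b) (divPow ((Complex.I / 2) • biP a b) k (u ⊗ₜ v)) := by
  rw [veyCoeff, biPow, divPow_smul, LinearMap.smul_apply, map_smul]

/-- Write `D` for `mixedD a b`. Here `X₁ = D ⊗ 1` and `X₂ = 1 ⊗ D` come from the two Wick orderings,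
`Z = i ∂q ⊗ ∂p` from the star product, and `Y = (i/2)(∂p ⊗ 1 + 1 ⊗ ∂p)(∂q ⊗ 1 + 1 ⊗ ∂q)` is `D`
transported through multiplication. The cross terms of `Y` are `(i/2)(∂p ⊗ ∂q + ∂q ⊗ ∂p)`; adding
`(i/2)P` cancels the first and doubles the second, which leaves `Z`. -/
theorem moyal_operator_eq (a b : EReal) :
    ∃ X₁ X₂ Z Y : Module.End ℂ (Symb a b ⊗[ℂ] Symb a b),
      (∀ n, divPow X₁ n = TensorProduct.map (divPow (mixedD a b) n) 1) ∧
      (∀ n, divPow X₂ n = TensorProduct.map 1 (divPow (mixedD a b) n)) ∧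
      (∀ n, divPow Z n =
        (Complex.I ^ n / (n.factorial : ℂ)) • TensorProduct.map (dQ a b ^ n) (dP a b ^ n)) ∧
      (∀ z, mixedD a b (LinearMap.mul' ℂ (Symb a b) z) = LinearMap.mul' ℂ (Symb a b) (Y z)) ∧
      Commute X₁ X₂ ∧ Commute Z (X₁ + X₂) ∧ Commute Y ((Complex.I / 2) • biP a b) ∧
      Z + (X₁ + X₂) = Y + (Complex.I / 2) • biP a b := by
  let L := Module.End.rTensorAlgHom ℂ (Symb a b) (Symb a b)
  let R := Module.End.lTensorAlgHom ℂ (Symb a b) (Symb a b)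
  have hL : ∀ f, L f = TensorProduct.map f 1 := fun _ => rfl
  have hR : ∀ f, R f = TensorProduct.map 1 f := fun _ => rfl
  have hLR : ∀ f g, L f * R g = TensorProduct.map f g := fun f g => by
    rw [hL, hR, ← TensorProduct.map_mul, mul_one, one_mul]
  have hRL : ∀ f g, R g * L f = TensorProduct.map f g := fun f g => by
    rw [hL, hR, ← TensorProduct.map_mul, mul_one, one_mul]
  have hc : ∀ f g, Commute (L f) (R g) := fun f g => (hLR f g).trans (hRL f g).symm
  have hpq := dP_dQ_comm a b
  have hpp : Commute (L (dP a b)) (L (dQ a b)) := hpq.map L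
  have hqq : Commute (R (dP a b)) (R (dQ a b)) := hpq.map R
  have hbi : biP a b = L (dQ a b) * R (dP a b) - L (dP a b) * R (dQ a b) := by
    rw [hLR, hLR, biP]
  refine ⟨L (mixedD a b), R (mixedD a b), Complex.I • (L (dQ a b) * R (dP a b)),
    (Complex.I / 2) • ((L (dP a b) + R (dP a b)) * (L (dQ a b) + R (dQ a b))),
    fun n => ?_, fun n => ?_, fun n => ?_, fun z => ?_, hc _ _, ?_, ?_, ?_⟩
  · rw [← map_divPow, hL]
  · rw [← map_divPow, hR]
  · rw [divPow_smul, (hc _ _).mul_pow, ← map_pow, ← map_pow, hLR]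
  -- The Leibniz rule for both derivations: on a product, each acts as the sum of its actions on the
  -- two factors.
  · induction z using TensorProduct.induction_on with
    | zero => simp
    | add z w hz hw => simp only [map_add, hz, hw]
    | tmul u v =>
      simp only [hL, hR, mixedD, LinearMap.smul_apply, Module.End.mul_apply, map_smul,
        LinearMap.add_apply, TensorProduct.map_tmul, map_add, Module.End.one_apply,
        LinearMap.mul'_apply, dQ_mul, dP_mul]
  · refine Commute.smul_left (Commute.add_right ?_ ?_) _
    · rw [mixedD, map_smul, map_mul]
      exact ((hpp.symm.mul_right (Commute.refl _)).mul_left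
        ((hc _ _).symm.mul_right (hc _ _).symm)).smul_right _
    · rw [mixedD, map_smul, map_mul]
      exact (((hc _ _).mul_right (hc _ _)).mul_left
        ((Commute.refl _).mul_right hqq)).smul_right _
  · refine (Commute.smul_left ?_ _).smul_right _
    rw [hbi]
    refine Commute.sub_right (Commute.mul_right ?_ ?_) (Commute.mul_right ?_ ?_)
    · exact ((hpp.add_left (hc _ _).symm).mul_left ((Commute.refl _).add_left (hc _ _).symm))
    · exact (((hc _ _).add_left (Commute.refl _)).mul_left ((hc _ _).add_left hqq.symm))
    · exact (((Commute.refl _).add_left (hc _ _).symm).mul_left (hpp.symm.add_left (hc _ _).symm))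
    · exact (((hc _ _).add_left hqq).mul_left ((hc _ _).add_left (Commute.refl _)))
  · rw [hbi, mixedD, map_smul, map_smul, map_mul, map_mul, ← smul_add, ← smul_add]
    -- One half of `Z` is matched with a cross term of `Y`, the other half with a term of `(i/2)P`.
    have h2 : Complex.I • (L (dQ a b) * R (dP a b)) =
        (Complex.I / 2) • (L (dQ a b) * R (dP a b) + L (dQ a b) * R (dP a b)) := by
      rw [← two_smul ℂ, smul_smul, div_mul_cancel₀ _ two_ne_zero]
    rw [h2, ← smul_add, add_mul, mul_add, mul_add, (hc (dQ a b) (dP a b)).eq]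
    congr 1
    abel

/-- Moyal's formula. The left side is the multiplication map after `exp(ε(Z + X₁ + X₂))`; rewriting
the exponent as `Y + (i/2)P` and moving `exp(εY)` through multiplication turns it into Wick ordering
of the Vey product. It holds for all symbols, not only trigonometric ones. -/
theorem coeff_wick_mul_wick (u v : Symb a b) (n : ℕ) :
    PowerSeries.coeff n (wick a b u * wick a b v).symb =
      ∑ kl ∈ Finset.HasAntidiagonal.antidiagonal n,
        PowerSeries.coeff kl.2 (wick a b (veyCoeff kl.1 u v)).symb := by
  obtain ⟨X₁, X₂, Z, Y, h₁, h₂, hZ, hY, hc, hcZ, hcY, he⟩ := moyal_operator_eq a b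
  have hL : PowerSeries.coeff n (wick a b u * wick a b v).symb =
      LinearMap.mul' ℂ (Symb a b) (divPow (Z + (X₁ + X₂)) n (u ⊗ₜ v)) := by
    rw [divPow_add hcZ, LinearMap.sum_apply, map_sum, Heis.mul_symb, starMul, PowerSeries.coeff_mk]
    refine Finset.sum_congr rfl fun kl _ => ?_
    rw [PowerSeries.coeff_mul, divPow_add hc, Module.End.mul_apply, LinearMap.sum_apply, map_sum,
      map_sum, Finset.smul_sum]
    refine Finset.sum_congr rfl fun ij _ => ?_
    rw [coeff_mapCoeff, coeff_mapCoeff, coeff_wick, coeff_wick, h₁, h₂, hZ, Module.End.mul_apply,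
      TensorProduct.map_tmul, TensorProduct.map_tmul, LinearMap.smul_apply,
      TensorProduct.map_tmul, map_smul, LinearMap.mul'_apply]
    rfl
  rw [hL, he, add_comm Y, divPow_add hcY.symm, LinearMap.sum_apply, map_sum]
  refine Finset.sum_congr rfl fun kl _ => ?_
  rw [coeff_wick, veyCoeff_eq, divPow_semiconj hY, (hcY.symm.divPow_divPow _ _).eq,
    Module.End.mul_apply]

theorem Heis.eps_pow_mul (N : ℕ) (u : Heis a b) :
    (eps a b ^ N * u).symb = PowerSeries.X ^ N * u.symb := by
  induction N with
  | zero => rw [pow_zero, pow_zero, one_mul, one_mul]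
  | succ N ih => rw [pow_succ', mul_assoc, eps_mul, ih, pow_succ', mul_assoc]

/-- The coefficient of `εⁿ` in an element of the Heisenberg algebra. -/
noncomputable def Heis.coeffHom (n : ℕ) : Heis a b →+ Symb a b :=
  (PowerSeries.coeff (R := Symb a b) n).toAddMonoidHom.comp Heis.symbHom

theorem Heis.coeffHom_apply (n : ℕ) (u : Heis a b) :
    Heis.coeffHom n u = PowerSeries.coeff n u.symb := rfl

theorem coeff_sum_eps_pow_mul_wick (c : ℕ → Symb a b) {n N : ℕ} (h : n < N) :
    PowerSeries.coeff n (∑ k ∈ Finset.range N, Heis.eps a b ^ k * wick a b (c k)).symb =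
      ∑ kl ∈ Finset.HasAntidiagonal.antidiagonal n,
        PowerSeries.coeff kl.2 (wick a b (c kl.1)).symb := by
  rw [← Heis.coeffHom_apply, map_sum, Finset.Nat.sum_antidiagonal_eq_sum_range_succ_mk,
    ← Finset.sum_subset (Finset.range_subset_range.mpr h)]
  · refine Finset.sum_congr rfl fun k hk => ?_
    rw [Heis.coeffHom_apply, Heis.eps_pow_mul, PowerSeries.coeff_X_pow_mul',
      if_pos (Nat.lt_succ_iff.mp (Finset.mem_range.mp hk))]
  · intro k _ hk
    rw [Heis.coeffHom_apply, Heis.eps_pow_mul, PowerSeries.coeff_X_pow_mul', if_neg]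
    simpa [Nat.lt_succ_iff] using hk

theorem biPow_zero (u v : Symb a b) : biPow 0 u v = u * v := by simp [biPow]

theorem biPow_one (u v : Symb a b) :
    biPow 1 u v = dQ a b u * dP a b v - dP a b u * dQ a b v := by
  simp [biPow, biP]

/-! ### Existence and uniqueness of Wick ordering -/

theorem veyCoeff_eq_zero_of_biP {u v : Symb a b} (h : biP a b (biP a b (u ⊗ₜ v)) = 0) {k : ℕ}
    (hk : 2 ≤ k) : veyCoeff k u v = 0 := by
  obtain ⟨k, rfl⟩ := Nat.exists_eq_add_of_le' hk
  rw [veyCoeff, biPow, pow_add (biP a b), Module.End.mul_apply, pow_two, Module.End.mul_apply, h, map_zero,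
    map_zero, smul_zero]

/-- The Vey product stops after first order when `P²` annihilates `u ⊗ v`. This is the case when `u`
is `p` or `q`, whose first derivatives are constant. -/
theorem wick_mul_wick_of_biP {u v : Symb a b} (h : biP a b (biP a b (u ⊗ₜ v)) = 0) :
    wick a b u * wick a b v =
      wick a b (u * v) + Heis.eps a b * wick a b ((Complex.I / 2) • biPow 1 u v) := by
  refine Heis.ext (PowerSeries.ext fun n => ?_)
  rw [coeff_wick_mul_wick, ← Heis.coeffHom_apply, map_add, Heis.coeffHom_apply,
    Heis.coeffHom_apply, Heis.eps_mul]
  have h0 : veyCoeff 0 u v = u * v := by simp [veyCoeff, biPow_zero]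
  have h1 : veyCoeff 1 u v = (Complex.I / 2) • biPow 1 u v := by simp [veyCoeff]
  rcases n with _ | n
  · rw [Finset.Nat.antidiagonal_zero, Finset.sum_singleton, h0, PowerSeries.coeff_zero_X_mul,
      add_zero]
  · rw [Finset.Nat.sum_antidiagonal_succ, h0, PowerSeries.coeff_succ_X_mul,
      Finset.sum_eq_single (0, n), zero_add, h1]
    · rintro ⟨k, l⟩ hkl hne
      rcases k with _ | k
      · refine absurd ?_ hne
        have := Finset.HasAntidiagonal.mem_antidiagonal.mp hkl
        simp only [zero_add] at this
        rw [this]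
      · rw [veyCoeff_eq_zero_of_biP h (by omega), coeff_wick, map_zero]
    · intro hn
      exact absurd (Finset.HasAntidiagonal.mem_antidiagonal.mpr (zero_add n)) hn

theorem wick_of_mixedD_eq_zero {u : Symb a b} (h : mixedD a b u = 0) :
    wick a b u = ⟨PowerSeries.C u⟩ := by
  refine Heis.ext (PowerSeries.ext fun n => ?_)
  rw [coeff_wick, PowerSeries.coeff_C]
  rcases n with _ | n
  · simp [divPow_zero]
  · rw [if_neg n.succ_ne_zero, divPow, LinearMap.smul_apply, pow_succ, Module.End.mul_apply, h,
      map_zero, smul_zero]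

theorem tmul_zero' (f : AnFun a b) : Symb.tmul f 0 = 0 := TensorProduct.tmul_zero _ _

theorem zero_tmul' (g : AnFun ⊥ ⊤) : Symb.tmul (0 : AnFun a b) g = 0 :=
  TensorProduct.zero_tmul _ _

theorem wick_p (a b : EReal) : wick a b (Symb.tmul (AnFun.coord a b) 1) = Heis.p a b := by
  rw [wick_of_mixedD_eq_zero]
  · exact Heis.ext (PowerSeries.map_C (Symb.ofP a b).toRingHom (AnFun.coord a b)).symm
  · rw [mixedD, LinearMap.smul_apply, Module.End.mul_apply, dQ_tmul, Derivation.map_one_eq_zero,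
      tmul_zero', map_zero, smul_zero]

theorem wick_q (a b : EReal) : wick a b (Symb.tmul 1 (AnFun.coord ⊥ ⊤)) = Heis.q a b := by
  rw [wick_of_mixedD_eq_zero]
  · rfl
  · rw [mixedD, LinearMap.smul_apply, Module.End.mul_apply, dQ_tmul, dP_tmul,
      Derivation.map_one_eq_zero, zero_tmul', smul_zero]

theorem wick_one (a b : EReal) : wick a b 1 = 1 := by
  rw [wick_of_mixedD_eq_zero]
  · exact Heis.ext (map_one _)
  · rw [mixedD, LinearMap.smul_apply, Module.End.mul_apply, Symb.one_def, dQ_tmul,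
      Derivation.map_one_eq_zero, tmul_zero', map_zero, smul_zero]

theorem p_mul_wick (u : Symb a b) :
    Heis.p a b * wick a b u = wick a b (Symb.tmul (AnFun.coord a b) 1 * u) -
      Heis.eps a b * wick a b ((Complex.I / 2) • dQ a b u) := by
  rw [← wick_p, wick_mul_wick_of_biP, biPow_one, dQ_tmul, dP_tmul, Derivation.map_one_eq_zero,
    tmul_zero', zero_mul, zero_sub, deriv_coord, ← Symb.one_def, one_mul, smul_neg, map_neg,
    mul_neg, sub_eq_add_neg]
  simp only [biP, LinearMap.sub_apply, TensorProduct.map_tmul, dQ_tmul, dP_tmul,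
    Derivation.map_one_eq_zero, tmul_zero', zero_tmul', TensorProduct.zero_tmul, deriv_coord,
    map_sub, map_zero, sub_zero]

theorem q_mul_wick (u : Symb a b) :
    Heis.q a b * wick a b u = wick a b (Symb.tmul 1 (AnFun.coord ⊥ ⊤) * u) +
      Heis.eps a b * wick a b ((Complex.I / 2) • dP a b u) := by
  rw [← wick_q, wick_mul_wick_of_biP, biPow_one, dQ_tmul, dP_tmul, Derivation.map_one_eq_zero,
    zero_tmul', zero_mul, sub_zero, deriv_coord, ← Symb.one_def, one_mul]
  simp only [biP, LinearMap.sub_apply, TensorProduct.map_tmul, dQ_tmul, dP_tmul,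
    Derivation.map_one_eq_zero, tmul_zero', zero_tmul', TensorProduct.zero_tmul, deriv_coord,
    sub_zero]

/-! ### Symmetrised words in `p` and `q` -/

/-- The sum of all words with `m` letters `x` and `N - m` letters `y`. -/
noncomputable def wordSum {A : Type*} [Ring A] (x y : A) (N m : ℕ) : A :=
  ∑ w : Fin N → Bool with (Finset.univ.filter fun i => w i = true).card = m,
    (List.ofFn fun i => if w i = true then x else y).prod

theorem wordSum_eq_zero {A : Type*} [Ring A] (x y : A) {N m : ℕ} (h : N < m) :
    wordSum x y N m = 0 := by
  rw [wordSum, Finset.filter_false_of_mem, Finset.sum_empty]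
  intro w _ hw
  have h1 := Finset.card_filter_le (Finset.univ : Finset (Fin N)) fun i => w i = true
  rw [hw, Finset.card_univ, Fintype.card_fin] at h1
  omega

theorem wordSum_zero {A : Type*} [Ring A] (x y : A) : wordSum x y 0 0 = 1 := by
  simp [wordSum]

/-- Words are sorted by their first letter, as in the proof of Pascal's rule. -/
theorem wordSum_succ_aux {A : Type*} [Ring A] (x y : A) (N m : ℕ) :
    wordSum x y (N + 1) m =
      (∑ w : Fin N → Bool with 1 + (Finset.univ.filter fun i => w i = true).card = m,
        x * (List.ofFn fun i => if w i = true then x else y).prod) + y * wordSum x y N m := by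
  rw [wordSum, Finset.sum_filter, ← (Fin.consEquiv fun _ : Fin (N + 1) => Bool).sum_comp,
    Fintype.sum_prod_type, Fintype.sum_bool, wordSum, Finset.mul_sum, Finset.sum_filter,
    Finset.sum_filter]
  have hw : ∀ (v : Bool) (w : Fin N → Bool),
      (if (Finset.univ.filter fun i => Fin.consEquiv (fun _ : Fin (N + 1) => Bool) (v, w) i =
          true).card = m then (List.ofFn fun i => if Fin.consEquiv
            (fun _ : Fin (N + 1) => Bool) (v, w) i = true then x else y).prod else 0) =
        if (if v = true then 1 else 0) + (Finset.univ.filter fun i => w i = true).card = m then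
          (if v = true then x else y) * (List.ofFn fun i => if w i = true then x else y).prod
        else 0 := by
    intro v w
    rw [Fin.card_filter_univ_succ', List.ofFn_succ, List.prod_cons]
    rfl
  congr 1 <;> refine Finset.sum_congr rfl fun w _ => (hw _ w).trans ?_ <;> simp

theorem wordSum_succ_zero {A : Type*} [Ring A] (x y : A) (N : ℕ) :
    wordSum x y (N + 1) 0 = y * wordSum x y N 0 := by
  rw [wordSum_succ_aux, Finset.filter_false_of_mem (by intros; omega), Finset.sum_empty, zero_add]

theorem wordSum_succ_succ {A : Type*} [Ring A] (x y : A) (N m : ℕ) :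
    wordSum x y (N + 1) (m + 1) = x * wordSum x y N m + y * wordSum x y N (m + 1) := by
  rw [wordSum_succ_aux]
  congr 1
  rw [wordSum, Finset.mul_sum]
  simp only [add_comm 1, add_left_inj]

/-- The monomial `pᵐ qⁿ`. -/
noncomputable def pqMonomial (a b : EReal) (m n : ℕ) : Symb a b :=
  Symb.tmul (AnFun.coord a b ^ m) (AnFun.coord ⊥ ⊤ ^ n)

theorem p_mul_pqMonomial (m n : ℕ) :
    Symb.tmul (AnFun.coord a b) 1 * pqMonomial a b m n = pqMonomial a b (m + 1) n := by
  rw [pqMonomial, Symb.tmul_mul_tmul, one_mul, ← pow_succ', pqMonomial]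

theorem q_mul_pqMonomial (m n : ℕ) :
    Symb.tmul 1 (AnFun.coord ⊥ ⊤) * pqMonomial a b m n = pqMonomial a b m (n + 1) := by
  rw [pqMonomial, Symb.tmul_mul_tmul, one_mul, ← pow_succ', pqMonomial]

theorem deriv_coord_pow (a b : EReal) (n : ℕ) :
    AnFun.deriv (AnFun.coord a b ^ n) = (n : ℂ) • AnFun.coord a b ^ (n - 1) := by
  rw [Derivation.leibniz_pow, deriv_coord, smul_eq_mul, mul_one, Nat.cast_smul_eq_nsmul]

theorem dP_pqMonomial (m n : ℕ) :
    dP a b (pqMonomial a b m n) = (m : ℂ) • pqMonomial a b (m - 1) n := by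
  rw [pqMonomial, dP_tmul, deriv_coord_pow, Symb.smul_tmul', pqMonomial]

theorem dQ_pqMonomial (m n : ℕ) :
    dQ a b (pqMonomial a b m n) = (n : ℂ) • pqMonomial a b m (n - 1) := by
  rw [pqMonomial, dQ_tmul, deriv_coord_pow, Symb.tmul_smul, pqMonomial]

/-- Induction on the length, removing the first letter. The terms of order zero add up by Pascal's
rule. The terms of order `ε` from a leading `p` and a leading `q` have opposite signs and cancel
because `C(N, m)(n + 1) = C(N, m + 1)(m + 1)`. -/
theorem wordSum_p_q (N : ℕ) : ∀ m n, m + n = N →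
    wordSum (Heis.p a b) (Heis.q a b) N m =
      ((N.choose m : ℕ) : ℂ) • wick a b (pqMonomial a b m n) := by
  induction N with
  | zero =>
    intro m n h
    obtain ⟨rfl, rfl⟩ : m = 0 ∧ n = 0 := by omega
    rw [wordSum_zero, pqMonomial, pow_zero, pow_zero, ← Symb.one_def, wick_one]
    simp
  | succ N ih =>
    intro m n h
    rcases m with _ | m
    · obtain rfl : n = N + 1 := by omega
      rw [wordSum_succ_zero, ih 0 N (by omega), mul_smul_comm, q_mul_wick, dP_pqMonomial,
        q_mul_pqMonomial]
      simp
    · rw [wordSum_succ_succ, ih m n (by omega), mul_smul_comm, p_mul_wick, p_mul_pqMonomial,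
        dQ_pqMonomial]
      -- When no letter `q` is left, no word starts with `q`, and the second sum is empty.
      rcases n with _ | n
      · obtain rfl : N = m := by omega
        rw [wordSum_eq_zero _ _ (Nat.lt_succ_self _)]
        simp
      · rw [ih (m + 1) n (by omega), mul_smul_comm, q_mul_wick, q_mul_pqMonomial, dP_pqMonomial]
        have hN : N = m + n + 1 := by omega
        have hc : ((N.choose m : ℕ) : ℂ) * (n + 1) = ((N.choose (m + 1) : ℕ) : ℂ) * (m + 1) := by
          have h1 := Nat.choose_succ_right_eq N m
          rw [hN, show m + n + 1 - m = n + 1 by omega, ← hN] at h1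
          exact_mod_cast h1.symm
        simp only [Nat.add_sub_cancel, map_smul, mul_smul_comm, Nat.cast_succ, smul_sub, smul_add,
          smul_smul, Nat.choose_succ_succ', Nat.cast_add]
        rw [show ((N.choose m : ℕ) : ℂ) * (Complex.I / 2 * (n + 1)) =
          ((N.choose (m + 1) : ℕ) : ℂ) * (Complex.I / 2 * (m + 1)) by
            linear_combination (Complex.I / 2) * hc]
        module

theorem wick_isWickOrdering (a b : EReal) : IsWickOrdering (wick a b) where
  monomial m n := by
    have h : (((m + n).choose m : ℕ) : ℂ) ≠ 0 := by
      exact_mod_cast (Nat.choose_pos (Nat.le_add_right m n)).ne'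
    have h1 := wordSum_p_q (a := a) (b := b) (m + n) m n rfl
    rw [wordSum] at h1
    rw [symAverage, h1, smul_smul, inv_mul_cancel₀ h, one_smul, pqMonomial]
  differential n := by
    refine ⟨{(n, n)}, fun _ => algebraMap ℂ _ ((Complex.I / 2) ^ n / (n.factorial : ℂ)),
      fun u => ?_⟩
    rw [coeff_wick, mixedD, divPow_smul, (dP_dQ_comm a b).mul_pow, Finset.sum_singleton,
      ← Algebra.smul_def]
    rfl

/-! ### Differential operators are determined by monomials -/

theorem dP_pow_pqMonomial (i m n : ℕ) :
    (dP a b ^ i) (pqMonomial a b m n) = (m.descFactorial i : ℂ) • pqMonomial a b (m - i) n := by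
  induction i with
  | zero => simp
  | succ i ih =>
    rw [pow_succ', Module.End.mul_apply, ih, map_smul, dP_pqMonomial, smul_smul,
      Nat.descFactorial_succ, Nat.cast_mul, mul_comm ((m - i : ℕ) : ℂ), Nat.sub_sub]

theorem dQ_pow_pqMonomial (j m n : ℕ) :
    (dQ a b ^ j) (pqMonomial a b m n) = (n.descFactorial j : ℂ) • pqMonomial a b m (n - j) := by
  induction j with
  | zero => simp
  | succ j ih =>
    rw [pow_succ', Module.End.mul_apply, ih, map_smul, dQ_pqMonomial, smul_smul,
      Nat.descFactorial_succ, Nat.cast_mul, mul_comm ((n - j : ℕ) : ℂ), Nat.sub_sub]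

/-- Testing on `p^m q^n` kills every term of index `(i, j)` with `i > m` or `j > n`. Among the
others, all but `(m, n)` have smaller total order and vanish by induction, which leaves `m! n!`
times the coefficient sought. -/
theorem differentialOperator_coeff_eq_zero (s : Finset (ℕ × ℕ)) (c : ℕ × ℕ → Symb a b)
    (h : ∀ m n, ∑ j ∈ s, c j * (dP a b ^ j.1) ((dQ a b ^ j.2) (pqMonomial a b m n)) = 0) :
    ∀ N m n, m + n = N → (m, n) ∈ s → c (m, n) = 0 := by
  intro N
  induction N using Nat.strong_induction_on with
  | _ N ih =>
    intro m n hmn hs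
    have h1 := h m n
    rw [Finset.sum_eq_single (m, n)] at h1
    · have h2 : pqMonomial a b 0 0 = 1 := by rw [pqMonomial, pow_zero, pow_zero, Symb.one_def]
      rw [dQ_pow_pqMonomial, map_smul, dP_pow_pqMonomial, Nat.sub_self, Nat.sub_self, h2,
        smul_smul, mul_smul_comm, mul_one] at h1
      refine (smul_eq_zero.mp h1).resolve_left ?_
      rw [Nat.descFactorial_self, Nat.descFactorial_self]
      exact_mod_cast mul_ne_zero n.factorial_ne_zero m.factorial_ne_zero
    · rintro ⟨i, j⟩ hij hne
      rw [dQ_pow_pqMonomial, map_smul, dP_pow_pqMonomial]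
      by_cases hi : m < i
      · rw [Nat.descFactorial_of_lt hi, Nat.cast_zero, zero_smul, smul_zero, mul_zero]
      by_cases hj : n < j
      · rw [Nat.descFactorial_of_lt hj, Nat.cast_zero, zero_smul, mul_zero]
      · rw [ih (i + j) ?_ i j rfl hij, zero_mul]
        have : i ≠ m ∨ j ≠ n := by
          by_contra! hc
          exact hne (by rw [hc.1, hc.2])
        omega
    · exact fun hn => absurd hs hn

theorem IsWickOrdering.unique {Ω Ω' : Symb a b →ₗ[ℂ] Heis a b} (h : IsWickOrdering Ω)
    (h' : IsWickOrdering Ω') : Ω = Ω' := by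
  classical
  refine LinearMap.ext fun u => Heis.ext (PowerSeries.ext fun n => ?_)
  obtain ⟨s, c, hc⟩ := h.differential n
  obtain ⟨s', c', hc'⟩ := h'.differential n
  -- The two operators may have different index sets; their coefficients are extended by zero so
  -- that the difference is a single operator indexed by the union.
  let d : ℕ × ℕ → Symb a b := fun j => (if j ∈ s then c j else 0) - if j ∈ s' then c' j else 0
  have hd : ∀ u, PowerSeries.coeff n (Ω u).symb - PowerSeries.coeff n (Ω' u).symb =
      ∑ j ∈ s ∪ s', d j * (dP a b ^ j.1) ((dQ a b ^ j.2) u) := by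
    intro u
    simp only [d, sub_mul, Finset.sum_sub_distrib, ite_mul, zero_mul, hc, hc']
    rw [← Finset.sum_filter, ← Finset.sum_filter, Finset.filter_mem_eq_inter,
      Finset.filter_mem_eq_inter, Finset.union_inter_cancel_left,
      Finset.union_inter_cancel_right]
  have h0 := differentialOperator_coeff_eq_zero (s ∪ s') d fun m k => by
    rw [← hd, pqMonomial, h.monomial, h'.monomial, sub_self]
  rw [← sub_eq_zero, hd]
  exact Finset.sum_eq_zero fun j hj => by rw [h0 _ j.1 j.2 rfl hj, zero_mul]

/-! ### Square roots of formal series -/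

/-- The coefficients of the square root of a formal series `F`, with leading coefficient `s₀`, when
`t` is an inverse of `2 s₀`. -/
noncomputable def sqrtCoeff {R : Type*} [CommRing R] (F : R⟦X⟧) (s₀ t : R) : ℕ → R
  | 0 => s₀
  | n + 1 => t * (PowerSeries.coeff (n + 1) F -
      ∑ i : Fin n, sqrtCoeff F s₀ t (i + 1) * sqrtCoeff F s₀ t (n - i))

/-- The coefficient of index `n + 1` in `s²` is `2 s₀ s_{n+1}` plus products of earlier
coefficients, so an inverse of `2 s₀` determines `s_{n+1}`. -/
theorem exists_sqrt_powerSeries {R : Type*} [CommRing R] (F : R⟦X⟧) {s₀ t : R}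
    (hs : s₀ * s₀ = PowerSeries.constantCoeff F) (ht : 2 * s₀ * t = 1) :
    ∃ s : R⟦X⟧, s * s = F ∧ PowerSeries.constantCoeff s = s₀ := by
  refine ⟨PowerSeries.mk (sqrtCoeff F s₀ t), PowerSeries.ext fun n => ?_, ?_⟩
  · simp only [PowerSeries.coeff_mul, PowerSeries.coeff_mk]
    rcases n with _ | n
    · rw [Finset.Nat.antidiagonal_zero, Finset.sum_singleton, sqrtCoeff, hs,
        PowerSeries.coeff_zero_eq_constantCoeff_apply]
    -- Both end terms, those that contain the new coefficient, are split off the convolution.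
    · rw [Finset.Nat.sum_antidiagonal_eq_sum_range_succ
        (fun i j => sqrtCoeff F s₀ t i * sqrtCoeff F s₀ t j), Finset.sum_range_succ,
        Finset.sum_range_succ', Nat.sub_self, Nat.sub_zero]
      simp only [Nat.add_sub_add_right]
      rw [Finset.sum_range fun i => sqrtCoeff F s₀ t (i + 1) * sqrtCoeff F s₀ t (n - i)]
      set S := ∑ i : Fin n, sqrtCoeff F s₀ t (i + 1) * sqrtCoeff F s₀ t (n - i) with hS
      have h0 : sqrtCoeff F s₀ t 0 = s₀ := by rw [sqrtCoeff]
      have h1 : sqrtCoeff F s₀ t (n + 1) = t * (PowerSeries.coeff (n + 1) F - S) := by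
        rw [sqrtCoeff]
      rw [h0, h1]
      linear_combination (PowerSeries.coeff (n + 1) F - S) * ht
  · rw [← PowerSeries.coeff_zero_eq_constantCoeff_apply, PowerSeries.coeff_mk, sqrtCoeff]

/-- A function with positive values. -/
def IsPosFun (f : AnFun a b) : Prop := ∀ z, ∃ y : ℝ, 0 < y ∧ f.1 z = y

theorem IsPosFun.isUnit {f : AnFun a b} (hf : IsPosFun f) : IsUnit f := by
  have hne : ∀ z, f.1 z ≠ 0 := fun z => by
    obtain ⟨y, hy, h⟩ := hf z
    rw [h]
    exact_mod_cast hy.ne'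
  refine IsUnit.of_mul_eq_one (AnFun.of (fun t => (extZero f.1 t)⁻¹) fun t ht =>
    (f.2 t ht).inv ?_) ?_
  · rw [extZero_apply f.1 ⟨t, ht⟩]
    exact hne _
  · ext z
    change f.1 z * (extZero f.1 z)⁻¹ = 1
    rw [extZero_apply, mul_inv_cancel₀ (hne z)]

theorem IsPosFun.exists_sqrt {f : AnFun a b} (hf : IsPosFun f) :
    ∃ s : AnFun a b, IsPosFun s ∧ s * s = f := by
  have hre : ∀ z : realIoo a b, 0 < (extZero f.1 z).re ∧ f.1 z = ((extZero f.1 z).re : ℂ) := by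
    intro z
    obtain ⟨y, hy, h⟩ := hf z
    rw [extZero_apply, h, Complex.ofReal_re]
    exact ⟨hy, rfl⟩
  -- The root is taken as `exp(log y / 2)`, which is analytic wherever `y > 0`.
  refine ⟨AnFun.of (fun t => ((Real.exp (Real.log (extZero f.1 t).re / 2) : ℝ) : ℂ)) fun t ht => ?_,
    fun z => ⟨_, Real.exp_pos _, rfl⟩, ?_⟩
  · have h1 : AnalyticAt ℝ (fun t => (extZero f.1 t).re) t :=
      (Complex.reCLM.analyticAt _).comp (f.2 t ht)
    exact (Complex.ofRealCLM.analyticAt _).comp ((h1.log (hre ⟨t, ht⟩).1).div_const.rexp)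
  · ext z
    change ((Real.exp (Real.log (extZero f.1 z).re / 2) : ℝ) : ℂ) *
      ((Real.exp (Real.log (extZero f.1 z).re / 2) : ℝ) : ℂ) = f.1 z
    rw [(hre z).2, ← Complex.ofReal_mul, ← Real.exp_add, add_halves, Real.exp_log (hre z).1]

theorem IsPosFun.add {f g : AnFun a b} (hf : IsPosFun f) (hg : IsPosFun g) : IsPosFun (f + g) := by
  intro z
  obtain ⟨y, hy, h⟩ := hf z
  obtain ⟨y', hy', h'⟩ := hg z
  exact ⟨y + y', add_pos hy hy', by
    change f.1 z + g.1 z = _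
    rw [h, h', Complex.ofReal_add]⟩

theorem exists_isPosSqrt {F : (AnFun a b)⟦X⟧} (hF : IsPosFun (PowerSeries.constantCoeff F)) :
    ∃ s, IsPosSqrt s F := by
  obtain ⟨s₀, hs₀, h⟩ := hF.exists_sqrt
  obtain ⟨t, ht⟩ := (hs₀.add hs₀).isUnit.exists_right_inv
  obtain ⟨s, hs, hs'⟩ := exists_sqrt_powerSeries F h (by rw [two_mul, ht])
  exact ⟨s, hs, hs' ▸ hs₀⟩

theorem isUnit_of_constantCoeff_isPos {F : (AnFun a b)⟦X⟧}
    (hF : IsPosFun (PowerSeries.constantCoeff F)) : IsUnit F :=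
  PowerSeries.isUnit_iff_constantCoeff.mpr hF.isUnit

/-- `(s + t)(s - t) = 0`, and `s + t` is a unit because its leading coefficient is positive. -/
theorem IsPosSqrt.unique {s t F : (AnFun a b)⟦X⟧} (hs : IsPosSqrt s F) (ht : IsPosSqrt t F) :
    s = t := by
  have hu : IsUnit (s + t) := isUnit_of_constantCoeff_isPos (by
    rw [map_add]
    exact IsPosFun.add hs.2 ht.2)
  have h : (s + t) * (s - t) = 0 := by
    linear_combination hs.1 - ht.1
  exact sub_eq_zero.mp (hu.mul_right_eq_zero.mp h)

/-- The shift is a homomorphism that fixes the leading coefficient. Hence a single root `σ` of `ρ`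
supplies the roots for both `X₊` and `X₋`. -/
theorem IsPosSqrt.epsShift {s F : (AnFun a b)⟦X⟧} (hs : IsPosSqrt s F) (c : ℂ) :
    IsPosSqrt (epsShift c s) (epsShift c F) := by
  refine ⟨?_, ?_⟩
  · rw [← hs.1]
    exact (map_mul (epsShiftHom c) s s).symm
  · rw [constantCoeff_epsShift]
    exact hs.2

theorem epsTaylor_isPos {ρ : ℝ → ℝ → ℝ}
    (hρ : ∀ z ∈ realIoo a b, AnalyticAt ℝ (fun x : ℝ × ℝ => ρ x.1 x.2) (z, 0))
    (hpos : ∀ z ∈ realIoo a b, 0 < ρ z 0) :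
    IsPosFun (PowerSeries.constantCoeff (epsTaylor ρ hρ)) := by
  intro z
  refine ⟨ρ z 0, hpos z z.2, ?_⟩
  rw [← PowerSeries.coeff_zero_eq_constantCoeff_apply, epsTaylor, PowerSeries.coeff_mk]
  change ((iteratedDeriv 0 (ρ z) 0 / ((0 : ℕ).factorial : ℝ) : ℝ) : ℂ) = _
  simp

variable {ρ σ : (AnFun a b)⟦X⟧}

/-! ### The Heisenberg coordinate homomorphism -/

/-- Moving `e^{-iq}` to the left past `σ(p + ε/2)` turns it into `σ(p - ε/2)`; the exponentials
cancel and two equal factors remain. -/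
theorem Heis.plus_mul_minus (h : IsPosSqrt σ ρ) :
    Heis.ofQ (expC 1) * Heis.ofP (epsShift (1 / 2) σ) *
      (Heis.ofQ (expC (-1)) * Heis.ofP (epsShift (-(1 / 2)) σ)) =
        Heis.ofP (epsShift (-(1 / 2)) ρ) := by
  rw [mul_assoc, ← mul_assoc (Heis.ofP _), Heis.ofP_mul_ofQ_expC, epsShift_epsShift, mul_assoc,
    ← mul_assoc, Heis.ofQ_expC_mul_neg, one_mul, show (-1 : ℂ) + 1 / 2 = -(1 / 2) by norm_num,
    ← (h.epsShift _).1]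
  exact (map_mul (Heis.ofPHom a b) _ _).symm

theorem Heis.minus_mul_plus (h : IsPosSqrt σ ρ) :
    Heis.ofQ (expC (-1)) * Heis.ofP (epsShift (-(1 / 2)) σ) *
      (Heis.ofQ (expC 1) * Heis.ofP (epsShift (1 / 2) σ)) =
        Heis.ofP (epsShift (1 / 2) ρ) := by
  rw [mul_assoc, ← mul_assoc (Heis.ofP _), Heis.ofP_mul_ofQ_expC, epsShift_epsShift, mul_assoc,
    ← mul_assoc, Heis.ofQ_expC_neg_mul, one_mul, show (1 : ℂ) + -(1 / 2) = 1 / 2 by norm_num,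
    ← (h.epsShift _).1]
  exact (map_mul (Heis.ofPHom a b) _ _).symm

/-- The images of the generators under the Heisenberg coordinate homomorphism. -/
noncomputable def heisGen (σ : (AnFun a b)⟦X⟧) : SurfGen a b → Heis a b
  | .plus => Heis.ofQ (expC 1) * Heis.ofP (epsShift (1 / 2) σ)
  | .minus => Heis.ofQ (expC (-1)) * Heis.ofP (epsShift (-(1 / 2)) σ)
  | .fn F => Heis.ofPHom a b F

theorem lift_heisGen_rel (h : IsPosSqrt σ ρ) ⦃x y : FreeAlgebra ℂ (SurfGen a b)⦄
    (hxy : SurfRel ρ x y) :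
    FreeAlgebra.lift ℂ (heisGen σ) x = FreeAlgebra.lift ℂ (heisGen σ) y := by
  cases hxy with
  | add F G => simp only [map_add, FreeAlgebra.lift_ι_apply, heisGen]
  | mul F G => simp only [map_mul, FreeAlgebra.lift_ι_apply, heisGen]
  | const c => simp only [FreeAlgebra.lift_ι_apply, heisGen, AlgHom.commutes]
  | fn_plus F =>
    simp only [map_mul, FreeAlgebra.lift_ι_apply, heisGen, Heis.ofPHom_apply]
    rw [← mul_assoc, Heis.ofP_mul_ofQ_expC, mul_assoc, mul_assoc]
    simp only [← Heis.ofPHom_apply, ← map_mul, mul_comm]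
  | fn_minus F =>
    simp only [map_mul, FreeAlgebra.lift_ι_apply, heisGen, Heis.ofPHom_apply]
    rw [← mul_assoc, Heis.ofP_mul_ofQ_expC, mul_assoc, mul_assoc]
    simp only [← Heis.ofPHom_apply, ← map_mul, mul_comm]
  | commutator =>
    simp only [map_sub, map_mul, FreeAlgebra.lift_ι_apply, heisGen, Heis.plus_mul_minus h,
      Heis.minus_mul_plus h, Heis.ofPHom_apply]
  | anticommutator =>
    simp only [map_add, map_mul, FreeAlgebra.lift_ι_apply, heisGen, Heis.plus_mul_minus h,
      Heis.minus_mul_plus h, Heis.ofPHom_apply]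

/-- The Heisenberg coordinate homomorphism. -/
noncomputable def heisCoord (h : IsPosSqrt σ ρ) : SurfAlg ρ →ₐ[ℂ] Heis a b :=
  RingQuot.liftAlgHom ℂ ⟨FreeAlgebra.lift ℂ (heisGen σ), lift_heisGen_rel h⟩

theorem heisCoord_ι (h : IsPosSqrt σ ρ) (g : SurfGen a b) :
    heisCoord h (RingQuot.mkAlgHom ℂ (SurfRel ρ) (FreeAlgebra.ι ℂ g)) = heisGen σ g := by
  rw [heisCoord, RingQuot.liftAlgHom_mkAlgHom_apply, FreeAlgebra.lift_ι_apply]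

theorem heisCoord_isHeisenbergCoord (h : IsPosSqrt σ ρ) : IsHeisenbergCoord (heisCoord h) where
  map_eps := (heisCoord_ι h _).trans Heis.ofP_X
  map_fn F := heisCoord_ι h _
  map_plus := ⟨epsShift (1 / 2) σ, h.epsShift _, by
    rw [expFun_eq, Int.cast_one]
    exact heisCoord_ι h _⟩
  map_minus := ⟨epsShift (-(1 / 2)) σ, h.epsShift _, by
    rw [expFun_eq, Int.cast_neg, Int.cast_one]
    exact heisCoord_ι h _⟩

theorem IsHeisenbergCoord.apply_plus {Ψ : SurfAlg ρ →ₐ[ℂ] Heis a b} (hΨ : IsHeisenbergCoord Ψ)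
    (h : IsPosSqrt σ ρ) :
    Ψ (SurfAlg.plus ρ) = Heis.ofQ (expFun 1) * Heis.ofP (epsShift (1 / 2) σ) := by
  obtain ⟨s, hs, he⟩ := hΨ.map_plus
  rw [he, hs.unique (h.epsShift _)]

theorem IsHeisenbergCoord.apply_minus {Ψ : SurfAlg ρ →ₐ[ℂ] Heis a b} (hΨ : IsHeisenbergCoord Ψ)
    (h : IsPosSqrt σ ρ) :
    Ψ (SurfAlg.minus ρ) = Heis.ofQ (expFun (-1)) * Heis.ofP (epsShift (-(1 / 2)) σ) := by
  obtain ⟨s, hs, he⟩ := hΨ.map_minus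
  rw [he, hs.unique (h.epsShift _)]

theorem IsHeisenbergCoord.unique {Ψ Ψ' : SurfAlg ρ →ₐ[ℂ] Heis a b} (hΨ : IsHeisenbergCoord Ψ)
    (hΨ' : IsHeisenbergCoord Ψ') (h : IsPosSqrt σ ρ) : Ψ = Ψ' := by
  refine RingQuot.ringQuot_ext' ℂ _ _ (FreeAlgebra.hom_ext (funext fun g => ?_))
  cases g with
  | plus => exact (hΨ.apply_plus h).trans (hΨ'.apply_plus h).symm
  | minus => exact (hΨ.apply_minus h).trans (hΨ'.apply_minus h).symm
  | fn F => exact (hΨ.map_fn F).trans (hΨ'.map_fn F).symm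

/-! ### Normal form in the noncommutative surface of rotation -/

namespace SurfAlg

/-- `F ↦ F(X₀, ε)` as a homomorphism. -/
noncomputable def fnHom (ρ : (AnFun a b)⟦X⟧) : (AnFun a b)⟦X⟧ →ₐ[ℂ] SurfAlg ρ :=
  have hc : ∀ c : ℂ, fn ρ (algebraMap ℂ _ c) = algebraMap ℂ _ c := fun c =>
    (RingQuot.mkAlgHom_rel ℂ (SurfRel.const c)).trans (AlgHom.commutes _ c)
  { toFun := fn ρ
    map_add' := fun F G => (RingQuot.mkAlgHom_rel ℂ (SurfRel.add F G)).trans (map_add _ _ _)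
    map_mul' := fun F G => (RingQuot.mkAlgHom_rel ℂ (SurfRel.mul F G)).trans (map_mul _ _ _)
    map_one' := by
      have h := hc 1
      rwa [map_one, map_one] at h
    map_zero' := by
      have h := hc 0
      rwa [map_zero, map_zero] at h
    commutes' := hc }

theorem fnHom_apply (F : (AnFun a b)⟦X⟧) : fnHom ρ F = fn ρ F := rfl

theorem fnHom_mul_plus (F : (AnFun a b)⟦X⟧) :
    fnHom ρ F * plus ρ = plus ρ * fnHom ρ (epsShift 1 F) := by
  have h := RingQuot.mkAlgHom_rel ℂ (SurfRel.fn_plus (ρ := ρ) F)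
  rwa [map_mul, map_mul] at h

theorem fnHom_mul_minus (F : (AnFun a b)⟦X⟧) :
    fnHom ρ F * minus ρ = minus ρ * fnHom ρ (epsShift (-1) F) := by
  have h := RingQuot.mkAlgHom_rel ℂ (SurfRel.fn_minus (ρ := ρ) F)
  rwa [map_mul, map_mul] at h

theorem commutator : plus ρ * minus ρ - minus ρ * plus ρ =
    fnHom ρ (epsShift (-(1 / 2)) ρ) - fnHom ρ (epsShift (1 / 2) ρ) := by
  have h := RingQuot.mkAlgHom_rel ℂ (SurfRel.commutator (ρ := ρ))
  rwa [map_sub, map_sub, map_mul, map_mul] at h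

theorem anticommutator : plus ρ * minus ρ + minus ρ * plus ρ =
    fnHom ρ (epsShift (-(1 / 2)) ρ) + fnHom ρ (epsShift (1 / 2) ρ) := by
  have h := RingQuot.mkAlgHom_rel ℂ (SurfRel.anticommutator (ρ := ρ))
  rwa [map_add, map_add, map_mul, map_mul] at h

/-- Half the sum of the commutator and anticommutator relations. -/
theorem plus_mul_minus : plus ρ * minus ρ = fnHom ρ (epsShift (-(1 / 2)) ρ) := by
  have h : (2 : ℂ) • (plus ρ * minus ρ) = (2 : ℂ) • fnHom ρ (epsShift (-(1 / 2)) ρ) := by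
    have h1 := congrArg₂ (· + ·) (commutator (ρ := ρ)) (anticommutator (ρ := ρ))
    simp only [sub_add_add_cancel] at h1
    rw [two_smul, two_smul]
    exact h1
  exact smul_right_injective _ two_ne_zero h

theorem minus_mul_plus : minus ρ * plus ρ = fnHom ρ (epsShift (1 / 2) ρ) := by
  have h := anticommutator (ρ := ρ)
  rw [plus_mul_minus] at h
  exact add_left_cancel h

/-- The functions `F(X₀, ε)` and a unit which plays the role of `e^{iq}` generate the surface. -/
theorem exists_unit (h : IsPosSqrt σ ρ) : ∃ E : (SurfAlg ρ)ˣ,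
    plus ρ = E * fnHom ρ (epsShift (1 / 2) σ) ∧
    minus ρ = ↑E⁻¹ * fnHom ρ (epsShift (-(1 / 2)) σ) := by
  obtain ⟨u, hu⟩ := isUnit_of_constantCoeff_isPos (h.epsShift (1 / 2)).2
  obtain ⟨v, hv⟩ := isUnit_of_constantCoeff_isPos (h.epsShift (-(1 / 2))).2
  have huv : ∀ t : ((AnFun a b)⟦X⟧)ˣ, fnHom ρ ↑t⁻¹ * fnHom ρ ↑t = 1 := fun t => by
    rw [← map_mul, Units.inv_mul, map_one]
  have huv' : ∀ t : ((AnFun a b)⟦X⟧)ˣ, fnHom ρ ↑t * fnHom ρ ↑t⁻¹ = 1 := fun t => by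
    rw [← map_mul, Units.mul_inv, map_one]
  -- `u = σ(z + ε/2)` and `v = σ(z - ε/2)` differ by a shift by `-ε`, and so do their inverses.
  have h1 : epsShift (-1) (↑u⁻¹ : (AnFun a b)⟦X⟧) = ↑v⁻¹ := by
    refine v.isUnit.mul_right_cancel ?_
    rw [Units.inv_mul, hv]
    have h2 : epsShift (-1) (↑u : (AnFun a b)⟦X⟧) = epsShift (-(1 / 2)) σ := by
      rw [hu, epsShift_epsShift]
      norm_num
    rw [← h2, ← epsShiftHom_apply, ← epsShiftHom_apply, ← map_mul, Units.inv_mul, map_one]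
  have h1' : epsShift 1 (↑v⁻¹ : (AnFun a b)⟦X⟧) = ↑u⁻¹ := by
    rw [← h1, epsShift_epsShift, add_neg_cancel, epsShift_zero]
  have e1 : plus ρ = plus ρ * fnHom ρ ↑u⁻¹ * fnHom ρ (epsShift (1 / 2) σ) := by
    rw [← hu, mul_assoc, huv, mul_one]
  have e2 : minus ρ = minus ρ * fnHom ρ ↑v⁻¹ * fnHom ρ (epsShift (-(1 / 2)) σ) := by
    rw [← hv, mul_assoc, huv, mul_one]
  -- Dividing the square roots out of `X₊` and `X₋` leaves two mutually inverse elements, since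
  -- `X₊X₋` and `X₋X₊` are the squares of `v` and `u`.
  refine ⟨⟨plus ρ * fnHom ρ ↑u⁻¹, minus ρ * fnHom ρ ↑v⁻¹, ?_, ?_⟩, e1, e2⟩
  · rw [mul_assoc, ← mul_assoc (fnHom ρ _), fnHom_mul_minus, h1, mul_assoc, ← mul_assoc,
      plus_mul_minus, ← (h.epsShift _).1, ← hv, map_mul, mul_assoc, ← mul_assoc (fnHom ρ _)
      (fnHom ρ _) (fnHom ρ _), huv', one_mul, huv']
  · rw [mul_assoc, ← mul_assoc (fnHom ρ _), fnHom_mul_plus, h1', mul_assoc, ← mul_assoc,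
      minus_mul_plus, ← (h.epsShift _).1, ← hu, map_mul, mul_assoc, ← mul_assoc (fnHom ρ _)
      (fnHom ρ _) (fnHom ρ _), huv', one_mul, huv']

/-- After multiplication on the right by the unit `σ(X₀ + ε/2)`, this is the defining relation
between `F(X₀, ε)` and `X₊`. -/
theorem unit_mul_fnHom (h : IsPosSqrt σ ρ) {E : (SurfAlg ρ)ˣ}
    (hE : plus ρ = E * fnHom ρ (epsShift (1 / 2) σ)) (F : (AnFun a b)⟦X⟧) :
    (E : SurfAlg ρ) * fnHom ρ F = fnHom ρ (epsShift (-1) F) * E := by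
  have hu := (isUnit_of_constantCoeff_isPos (h.epsShift (1 / 2)).2).map (fnHom ρ)
  refine hu.mul_right_cancel ?_
  rw [mul_assoc (fnHom ρ _), ← hE, fnHom_mul_plus, epsShift_epsShift, add_neg_cancel,
    epsShift_zero, hE, mul_assoc, mul_assoc, ← map_mul, ← map_mul, mul_comm F]

theorem unit_inv_mul_fnHom (h : IsPosSqrt σ ρ) {E : (SurfAlg ρ)ˣ}
    (hE : plus ρ = E * fnHom ρ (epsShift (1 / 2) σ)) (F : (AnFun a b)⟦X⟧) :
    (↑E⁻¹ : SurfAlg ρ) * fnHom ρ F = fnHom ρ (epsShift 1 F) * ↑E⁻¹ := by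
  rw [Units.eq_mul_inv_iff_mul_eq, mul_assoc, Units.inv_mul_eq_iff_eq_mul,
    unit_mul_fnHom h hE, epsShift_epsShift, neg_add_cancel, epsShift_zero]

/-- The element `∑ F_r(X₀, ε) Eʳ`. -/
noncomputable def laurent (E : (SurfAlg ρ)ˣ) : (ℤ →₀ (AnFun a b)⟦X⟧) →ₗ[ℂ] SurfAlg ρ :=
  Finsupp.lsum ℂ fun r =>
    LinearMap.mulRight ℂ (↑(E ^ r) : SurfAlg ρ) ∘ₗ (fnHom ρ).toLinearMap

theorem laurent_single (E : (SurfAlg ρ)ˣ) (r : ℤ) (F : (AnFun a b)⟦X⟧) :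
    laurent E (Finsupp.single r F) = fnHom ρ F * ↑(E ^ r) := by
  simp [laurent]

/-- The range contains `1` and is stable under left multiplication by `F(X₀, ε)`, `E` and `E⁻¹`,
hence by all generators; so it is the whole algebra. -/
theorem laurent_surjective (h : IsPosSqrt σ ρ) {E : (SurfAlg ρ)ˣ}
    (hE : plus ρ = E * fnHom ρ (epsShift (1 / 2) σ))
    (hE' : minus ρ = ↑E⁻¹ * fnHom ρ (epsShift (-(1 / 2)) σ)) :
    Function.Surjective (laurent E) := by
  have hclosed : ∀ z : SurfAlg ρ,
      (∀ (r : ℤ) F, z * (fnHom ρ F * ↑(E ^ r)) ∈ LinearMap.range (laurent E)) →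
        ∀ m ∈ LinearMap.range (laurent E), z * m ∈ LinearMap.range (laurent E) := by
    rintro z hz _ ⟨G, rfl⟩
    induction G using Finsupp.induction_linear with
    | zero => rw [map_zero, mul_zero]; exact zero_mem _
    | add G G' hG hG' => rw [map_add, mul_add]; exact add_mem hG hG'
    | single r F => rw [laurent_single]; exact hz r F
  have hfn : ∀ G, ∀ m ∈ LinearMap.range (laurent E), fnHom ρ G * m ∈ LinearMap.range (laurent E) :=
    fun G => hclosed _ fun r F => ⟨Finsupp.single r (G * F), by
      rw [laurent_single, map_mul, mul_assoc]⟩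
  have hp : ∀ m ∈ LinearMap.range (laurent E), ↑E * m ∈ LinearMap.range (laurent E) :=
    hclosed _ fun r F => ⟨Finsupp.single (1 + r) (epsShift (-1) F), by
      rw [laurent_single, ← mul_assoc, unit_mul_fnHom h hE, mul_assoc, zpow_add, zpow_one,
        Units.val_mul]⟩
  have hm : ∀ m ∈ LinearMap.range (laurent E), ↑E⁻¹ * m ∈ LinearMap.range (laurent E) :=
    hclosed _ fun r F => ⟨Finsupp.single (-1 + r) (epsShift 1 F), by
      rw [laurent_single, ← mul_assoc, unit_inv_mul_fnHom h hE, mul_assoc, zpow_add, zpow_neg_one,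
        Units.val_mul]⟩
  have hall : ∀ y : FreeAlgebra ℂ (SurfGen a b), ∀ m ∈ LinearMap.range (laurent E),
      RingQuot.mkAlgHom ℂ (SurfRel ρ) y * m ∈ LinearMap.range (laurent E) := by
    intro y
    induction y using FreeAlgebra.induction with
    | grade0 c =>
      intro m hm'
      rw [AlgHom.commutes, ← Algebra.smul_def]
      exact Submodule.smul_mem _ c hm'
    | grade1 g =>
      intro m hm'
      cases g with
      | plus =>
        change plus ρ * m ∈ _
        rw [hE, mul_assoc]
        exact hp _ (hfn _ _ hm')
      | minus =>
        change minus ρ * m ∈ _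
        rw [hE', mul_assoc]
        exact hm _ (hfn _ _ hm')
      | fn F => exact hfn F m hm'
    | mul y z hy hz =>
      intro m hm'
      rw [map_mul, mul_assoc]
      exact hy _ (hz _ hm')
    | add y z hy hz =>
      intro m hm'
      rw [map_add, add_mul]
      exact add_mem (hy _ hm') (hz _ hm')
  intro x
  obtain ⟨y, rfl⟩ := RingQuot.mkAlgHom_surjective ℂ (SurfRel ρ) x
  have h1 : (1 : SurfAlg ρ) ∈ LinearMap.range (laurent E) :=
    ⟨Finsupp.single 0 1, by rw [laurent_single, map_one, zpow_zero, one_mul, Units.val_one]⟩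
  have h2 := hall y 1 h1
  rwa [mul_one] at h2

end SurfAlg

/-- The unit `σ(p + ε/2)` cancels from the formula for `Ψ(X₊)`, which leaves `Ψ(E) = e^{iq}`; the
powers follow. -/
theorem IsHeisenbergCoord.apply_unit_zpow {Ψ : SurfAlg ρ →ₐ[ℂ] Heis a b}
    (hΨ : IsHeisenbergCoord Ψ) (h : IsPosSqrt σ ρ) {E : (SurfAlg ρ)ˣ}
    (hE : SurfAlg.plus ρ = E * SurfAlg.fnHom ρ (epsShift (1 / 2) σ)) (r : ℤ) :
    Ψ ↑(E ^ r) = Heis.ofQ (expFun r) := by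
  have hu := (isUnit_of_constantCoeff_isPos (h.epsShift (1 / 2)).2).map (Heis.ofPHom a b)
  have h1 : Ψ E = Heis.ofQ (expC 1) := by
    have h2 := hΨ.apply_plus h
    rw [hE, map_mul, SurfAlg.fnHom_apply, hΨ.map_fn, expFun_eq, Int.cast_one] at h2
    exact hu.mul_right_cancel h2
  let U : (Heis a b)ˣ := ⟨Heis.ofQ (expC 1), Heis.ofQ (expC (-1)), Heis.ofQ_expC_mul_neg 1,
    Heis.ofQ_expC_neg_mul 1⟩
  have h3 : Units.map (Ψ : SurfAlg ρ →* Heis a b) E = U := Units.ext h1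
  have h4 : ∀ n : ℕ, (↑(U ^ n) : Heis a b) = Heis.ofQ (expC n) ∧
      (↑((U ^ n)⁻¹) : Heis a b) = Heis.ofQ (expC (-n)) := by
    intro n
    induction n with
    | zero => simp [expC_zero, Heis.ofQ_one]
    | succ n ih =>
      refine ⟨?_, ?_⟩
      · rw [pow_succ, Units.val_mul, ih.1, Nat.cast_succ, ← Heis.ofQ_expC_mul]
      · rw [pow_succ', mul_inv_rev, Units.val_mul, ih.2, Nat.cast_succ, neg_add,
          ← Heis.ofQ_expC_mul]
        rfl
  have h5 : Ψ ↑(E ^ r) = ↑(U ^ r) := by rw [← h3, ← map_zpow]; rfl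
  rw [h5, expFun_eq]
  obtain ⟨n, rfl | rfl⟩ := r.eq_nat_or_neg
  · rw [zpow_natCast, (h4 n).1, Int.cast_natCast]
  · rw [zpow_neg, zpow_natCast, (h4 n).2, Int.cast_neg, Int.cast_natCast]

/-- All that is needed of the normal form later on, with `E` eliminated. -/
theorem IsHeisenbergCoord.exists_laurent {Ψ : SurfAlg ρ →ₐ[ℂ] Heis a b}
    (hΨ : IsHeisenbergCoord Ψ) (h : IsPosSqrt σ ρ) :
    ∃ Λ : (ℤ →₀ (AnFun a b)⟦X⟧) →ₗ[ℂ] SurfAlg ρ, Function.Surjective Λ ∧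
      ∀ r F, Ψ (Λ (Finsupp.single r F)) = Heis.ofP F * Heis.ofQ (expFun r) := by
  obtain ⟨E, hE, hE'⟩ := SurfAlg.exists_unit h
  refine ⟨SurfAlg.laurent E, SurfAlg.laurent_surjective h hE hE', fun r F => ?_⟩
  rw [SurfAlg.laurent_single, map_mul, hΨ.apply_unit_zpow h hE, SurfAlg.fnHom_apply, hΨ.map_fn]

/-! ### Injectivity of the Heisenberg coordinates -/

/-- The trigonometric symbols: finite sums of functions `f(p) e^{irq}`. -/
noncomputable def trigSymb (a b : EReal) : Submodule ℂ (Symb a b) :=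
  Submodule.span ℂ {u | ∃ f r, u = Symb.tmul f (expFun r)}

theorem tmul_expFun_mem (f : AnFun a b) (r : ℤ) : Symb.tmul f (expFun r) ∈ trigSymb a b :=
  Submodule.subset_span ⟨f, r, rfl⟩

theorem trigSymb_le {V : Submodule ℂ (Symb a b)} (h : ∀ f r, Symb.tmul f (expFun r) ∈ V) :
    trigSymb a b ≤ V :=
  Submodule.span_le.mpr fun _ ⟨f, r, hu⟩ => hu ▸ h f r

theorem dP_mem_trigSymb {u : Symb a b} (hu : u ∈ trigSymb a b) : dP a b u ∈ trigSymb a b :=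
  trigSymb_le (V := (trigSymb a b).comap (dP a b)) (fun _ r => tmul_expFun_mem _ r) hu

theorem dQ_mem_trigSymb {u : Symb a b} (hu : u ∈ trigSymb a b) : dQ a b u ∈ trigSymb a b :=
  trigSymb_le (V := (trigSymb a b).comap (dQ a b)) (fun f r => by
    rw [Submodule.mem_comap, expFun_eq, dQ_tmul_expC]
    exact Submodule.smul_mem _ _ (tmul_expFun_mem f r)) hu

theorem mul_mem_trigSymb {u v : Symb a b} (hu : u ∈ trigSymb a b) (hv : v ∈ trigSymb a b) :
    u * v ∈ trigSymb a b := by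
  refine trigSymb_le (V := (trigSymb a b).comap (LinearMap.mulRight ℂ v)) (fun f r => ?_) hu
  refine trigSymb_le (V := (trigSymb a b).comap (LinearMap.mulLeft ℂ (Symb.tmul f (expFun r))))
    (fun g s => ?_) hv
  rw [Submodule.mem_comap, LinearMap.mulLeft_apply, Symb.tmul_mul_tmul, expFun_eq, expFun_eq,
    ← expC_add, ← Int.cast_add]
  exact tmul_expFun_mem _ _

/-- The span `T` of tensors of trigonometric symbols is stable under `P`, and multiplication maps it
to trigonometric symbols. This places the Vey coefficients in the image of `Ψ⁰`. -/
theorem veyCoeff_mem_trigSymb {u v : Symb a b} (hu : u ∈ trigSymb a b) (hv : v ∈ trigSymb a b)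
    (k : ℕ) : veyCoeff k u v ∈ trigSymb a b := by
  let T : Submodule ℂ (Symb a b ⊗[ℂ] Symb a b) :=
    Submodule.span ℂ {z | ∃ x ∈ trigSymb a b, ∃ y ∈ trigSymb a b, z = x ⊗ₜ y}
  have hT : ∀ x ∈ trigSymb a b, ∀ y ∈ trigSymb a b, x ⊗ₜ[ℂ] y ∈ T := fun x hx y hy =>
    Submodule.subset_span ⟨x, hx, y, hy, rfl⟩
  have h1 : T ≤ T.comap (biP a b) := Submodule.span_le.mpr <| by
    rintro _ ⟨x, hx, y, hy, rfl⟩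
    exact sub_mem (hT _ (dQ_mem_trigSymb hx) _ (dP_mem_trigSymb hy))
      (hT _ (dP_mem_trigSymb hx) _ (dQ_mem_trigSymb hy))
  have h2 : T ≤ (trigSymb a b).comap (LinearMap.mul' ℂ (Symb a b)) := Submodule.span_le.mpr <| by
    rintro _ ⟨x, hx, y, hy, rfl⟩
    exact mul_mem_trigSymb hx hy
  have h3 : (biP a b ^ k) (u ⊗ₜ v) ∈ T := by
    induction k with
    | zero => exact hT _ hu _ hv
    | succ k ih =>
      rw [pow_succ', Module.End.mul_apply]
      exact h1 ih
  exact Submodule.smul_mem _ _ (h2 h3)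

/-- On `f(p) e^{irq}` the operator `(i/2) ∂p∂q` acts as `-(r/2) ∂p`, whose exponential is the shift
by `-rε/2`. -/
theorem wick_tmul_expFun (f : AnFun a b) (r : ℤ) :
    wick a b (Symb.tmul f (expFun r)) =
      Heis.ofP (epsShift (-(r : ℂ) / 2) (PowerSeries.C f)) * Heis.ofQ (expFun r) := by
  refine Heis.ext (PowerSeries.ext fun n => ?_)
  rw [coeff_wick, Heis.coeff_ofP_mul_ofQ, coeff_epsShift_C]
  let T : AnFun a b →ₗ[ℂ] Symb a b :=
    { toFun := fun g => Symb.tmul g (expFun r)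
      map_add' := fun g g' => Symb.add_tmul g g' _
      map_smul' := fun c g => Symb.smul_tmul' c g _ }
  refine divPow_semiconj (f := T) (fun g => ?_) n f
  change mixedD a b (Symb.tmul g (expFun r)) = Symb.tmul ((-(r : ℂ) / 2) • AnFun.deriv g) (expFun r)
  rw [mixedD, LinearMap.smul_apply, Module.End.mul_apply, expFun_eq, dQ_tmul_expC, map_smul,
    dP_tmul, smul_smul, Symb.smul_tmul']
  congr 1
  linear_combination (r : ℂ) / 2 * Complex.I_mul_I

/-- Moving `e^{irq}` to the left adds `r` to the shift, and `-r/2 + r = r/2`: the argument lies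
midway between the two one-sided orderings. -/
theorem wick_tmul_expFun' (f : AnFun a b) (r : ℤ) :
    wick a b (Symb.tmul f (expFun r)) =
      Heis.ofQ (expFun r) * Heis.ofP (epsShift ((r : ℂ) / 2) (PowerSeries.C f)) := by
  rw [wick_tmul_expFun, expFun_eq, Heis.ofP_mul_ofQ_expC, epsShift_epsShift]
  congr 3
  ring

theorem Heis.classical_eq_coeffHom (u : Heis a b) : Heis.classical a b u = Heis.coeffHom 0 u := rfl

theorem Heis.classical_wick (u : Symb a b) : Heis.classical a b (wick a b u) = u := by
  rw [Heis.classical_eq_coeffHom, Heis.coeffHom_apply, coeff_wick, divPow_zero,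
    Module.End.one_apply]

theorem Heis.coeffHom_one_mul (u v : Heis a b) :
    Heis.coeffHom 1 (u * v) =
      Heis.coeffHom 0 u * Heis.coeffHom 1 v + Heis.coeffHom 1 u * Heis.coeffHom 0 v +
        Complex.I • (dQ a b (Heis.coeffHom 0 u) * dP a b (Heis.coeffHom 0 v)) := by
  have h : (Finset.HasAntidiagonal.antidiagonal 1 : Finset (ℕ × ℕ)) = {(0, 1), (1, 0)} := rfl
  simp only [Heis.coeffHom_apply, Heis.mul_symb, starMul, PowerSeries.coeff_mk, h]
  rw [Finset.sum_pair (by simp), PowerSeries.coeff_mul, PowerSeries.coeff_mul, h,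
    Finset.sum_pair (by simp)]
  simp [coeff_mapCoeff]

section Coordinates

variable {Ψ : SurfAlg ρ →ₐ[ℂ] Heis a b} {Λ : (ℤ →₀ (AnFun a b)⟦X⟧) →ₗ[ℂ] SurfAlg ρ}

theorem coeffHom_laurent
    (hΛ : ∀ r F, Ψ (Λ (Finsupp.single r F)) = Heis.ofP F * Heis.ofQ (expFun r))
    (G : ℤ →₀ (AnFun a b)⟦X⟧) (n : ℕ) :
    Heis.coeffHom n (Ψ (Λ G)) =
      G.sum fun r F => Symb.tmul (PowerSeries.coeff n F) (expFun r) := by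
  induction G using Finsupp.induction_linear with
  | zero => simp
  | add G G' h h' =>
    rw [map_add, map_add, map_add, h, h', Finsupp.sum_add_index']
    · intro r
      rw [map_zero, zero_tmul']
    · intro r F F'
      rw [map_add, Symb.add_tmul]
  | single r F =>
    rw [hΛ, Finsupp.sum_single_index, Heis.coeffHom_apply, Heis.coeff_ofP_mul_ofQ]
    rw [map_zero, zero_tmul']

/-- The Fourier coefficient functional isolates the contribution of each `r`. -/
theorem coeff_eq_zero_of_coeffHom_laurent
    (hΛ : ∀ r F, Ψ (Λ (Finsupp.single r F)) = Heis.ofP F * Heis.ofQ (expFun r))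
    {G : ℤ →₀ (AnFun a b)⟦X⟧} {n : ℕ} (h : Heis.coeffHom n (Ψ (Λ G)) = 0) (r : ℤ) :
    PowerSeries.coeff n (G r) = 0 := by
  obtain ⟨φ, hφ⟩ := exists_coeff_expFun a b r
  rw [coeffHom_laurent hΛ] at h
  have h1 := congrArg φ h
  rw [map_zero, map_finsuppSum] at h1
  simp only [hφ] at h1
  rw [Finsupp.sum_ite_eq'] at h1
  split_ifs at h1 with hr
  · exact h1
  · rw [Finsupp.notMem_support_iff.mp hr, map_zero]

theorem IsHeisenbergCoord.injective (hΨ : IsHeisenbergCoord Ψ) (h : IsPosSqrt σ ρ) :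
    Function.Injective Ψ := by
  obtain ⟨Λ, hsurj, hΛ⟩ := hΨ.exists_laurent h
  rw [injective_iff_map_eq_zero]
  intro x hx
  obtain ⟨G, rfl⟩ := hsurj x
  have hG : G = 0 := Finsupp.ext fun r => PowerSeries.ext fun n =>
    coeff_eq_zero_of_coeffHom_laurent hΛ (by rw [hx, map_zero]) r
  rw [hG, map_zero]

/-- If the low orders of `Ψ(x)` vanish, so do those of every `F_r`. Dividing each of these finitely
many series by `ε^N` gives a quotient inside the surface, not merely in the Heisenberg algebra. -/
theorem IsHeisenbergCoord.exists_eps_pow_mul (hΨ : IsHeisenbergCoord Ψ) (h : IsPosSqrt σ ρ)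
    {N : ℕ} {x : SurfAlg ρ} (hx : ∀ n < N, Heis.coeffHom n (Ψ x) = 0) :
    ∃ y, x = SurfAlg.eps ρ ^ N * y := by
  obtain ⟨Λ, hsurj, hΛ⟩ := hΨ.exists_laurent h
  obtain ⟨G, rfl⟩ := hsurj x
  let d : (AnFun a b)⟦X⟧ → (AnFun a b)⟦X⟧ := fun F =>
    PowerSeries.mk fun n => PowerSeries.coeff (n + N) F
  have hd : d 0 = 0 := by
    ext1 n
    simp [d]
  refine ⟨Λ (G.mapRange d hd), hΨ.injective h (Heis.ext (PowerSeries.ext fun n => ?_))⟩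
  rw [map_mul, map_pow, hΨ.map_eps, Heis.eps_pow_mul, PowerSeries.coeff_X_pow_mul']
  split_ifs with hn
  · rw [← Heis.coeffHom_apply, ← Heis.coeffHom_apply, coeffHom_laurent hΛ, coeffHom_laurent hΛ,
      Finsupp.sum_mapRange_index]
    · simp only [d, PowerSeries.coeff_mk, Nat.sub_add_cancel hn]
    · intro r
      rw [map_zero, zero_tmul']
  · exact hx n (not_le.mp hn)

theorem SurfAlg.toClassical_surjective (ρ : (AnFun a b)⟦X⟧) :
    Function.Surjective (SurfAlg.toClassical ρ) := RingQuot.mkAlgHom_surjective ℂ _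

theorem SurfAlg.toClassical_eps (ρ : (AnFun a b)⟦X⟧) :
    SurfAlg.toClassical ρ (SurfAlg.eps ρ) = 0 :=
  (RingQuot.mkAlgHom_rel ℂ (s := fun x y : SurfAlg ρ => x = SurfAlg.eps ρ ∧ y = 0)
    ⟨rfl, rfl⟩).trans (map_zero _)

/-- An element whose image has no term of order zero is a multiple of `ε`, hence zero in `A⁰`. -/
theorem IsHeisenbergCoord.classical_injective (hΨ : IsHeisenbergCoord Ψ) (h : IsPosSqrt σ ρ) :
    Function.Injective hΨ.classical := by
  rw [injective_iff_map_eq_zero]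
  intro u hu
  obtain ⟨x, rfl⟩ := SurfAlg.toClassical_surjective ρ u
  rw [hΨ.classical_toClassical] at hu
  obtain ⟨y, rfl⟩ := hΨ.exists_eps_pow_mul h (N := 1) (x := x) fun n hn => by
    rw [Nat.lt_one_iff.mp hn]
    exact hu
  rw [pow_one, map_mul, SurfAlg.toClassical_eps, zero_mul]

theorem IsHeisenbergCoord.classical_mem_trigSymb (hΨ : IsHeisenbergCoord Ψ) (h : IsPosSqrt σ ρ)
    (u : SurfAlg.Classical ρ) : hΨ.classical u ∈ trigSymb a b := by
  obtain ⟨Λ, hsurj, hΛ⟩ := hΨ.exists_laurent h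
  obtain ⟨x, rfl⟩ := SurfAlg.toClassical_surjective ρ u
  obtain ⟨G, rfl⟩ := hsurj x
  rw [hΨ.classical_toClassical, Heis.classical_eq_coeffHom, coeffHom_laurent hΛ]
  exact Submodule.sum_mem _ fun r _ => tmul_expFun_mem _ r

/-- With the preceding lemma: the image of `Ψ⁰` is exactly the space of trigonometric symbols. -/
theorem IsHeisenbergCoord.exists_classical_eq (hΨ : IsHeisenbergCoord Ψ) (h : IsPosSqrt σ ρ)
    {w : Symb a b} (hw : w ∈ trigSymb a b) : ∃ u, hΨ.classical u = w := by
  obtain ⟨Λ, -, hΛ⟩ := hΨ.exists_laurent h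
  refine trigSymb_le (V := LinearMap.range hΨ.classical.toLinearMap) (fun f r =>
    ⟨SurfAlg.toClassical ρ (Λ (Finsupp.single r (PowerSeries.C f))), ?_⟩) hw
  rw [AlgHom.toLinearMap_apply, hΨ.classical_toClassical, hΛ, Heis.classical_eq_coeffHom,
    Heis.coeffHom_apply, Heis.coeff_ofP_mul_ofQ, PowerSeries.coeff_zero_C]

theorem IsHeisenbergCoord.exists_eq_wick (hΨ : IsHeisenbergCoord Ψ) (h : IsPosSqrt σ ρ)
    {w : Symb a b} (hw : w ∈ trigSymb a b) : ∃ x, Ψ x = wick a b w := by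
  obtain ⟨Λ, -, hΛ⟩ := hΨ.exists_laurent h
  refine trigSymb_le (V := (LinearMap.range Ψ.toLinearMap).comap (wick a b)) (fun f r =>
    ⟨Λ (Finsupp.single r (epsShift (-(r : ℂ) / 2) (PowerSeries.C f))), ?_⟩) hw
  rw [AlgHom.toLinearMap_apply, hΛ, wick_tmul_expFun]

/-! ### The central ordering -/

/-- Both conditions agree on the functions `f(p) e^{irq}`, and these span the image of `Ψ⁰`. All
later statements about the central ordering use the right-hand form. -/
theorem isCentralOrdering_iff (hΨ : IsHeisenbergCoord Ψ) (h : IsPosSqrt σ ρ)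
    (Ω : SurfAlg.Classical ρ →ₗ[ℂ] SurfAlg ρ) :
    IsCentralOrdering hΨ Ω ↔ ∀ u, Ψ (Ω u) = wick a b (hΨ.classical u) := by
  refine ⟨fun hΩ u => ?_, fun hΩ u r f hu => by rw [hΩ, hu, wick_tmul_expFun']⟩
  -- The subspace where the two linear maps agree has full image under `Ψ⁰`; injectivity of `Ψ⁰`
  -- then makes it everything.
  have key : trigSymb a b ≤ (LinearMap.eqLocus (Ψ.toLinearMap ∘ₗ Ω)
      (wick a b ∘ₗ hΨ.classical.toLinearMap)).map hΨ.classical.toLinearMap := by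
    refine trigSymb_le fun f r => ?_
    obtain ⟨v, hv⟩ := hΨ.exists_classical_eq h (tmul_expFun_mem f r)
    refine ⟨v, ?_, hv⟩
    change Ψ (Ω v) = wick a b (hΨ.classical v)
    rw [hΩ v r f hv, hv, wick_tmul_expFun']
  obtain ⟨v, hv, hvu⟩ := key (hΨ.classical_mem_trigSymb h u)
  rw [← hΨ.classical_injective h hvu]
  exact hv

theorem exists_centralOrdering (hΨ : IsHeisenbergCoord Ψ) (h : IsPosSqrt σ ρ) :
    ∃ Ω : SurfAlg.Classical ρ →ₗ[ℂ] SurfAlg ρ, IsCentralOrdering hΨ Ω := by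
  -- Preimages are chosen pointwise; linearity is automatic because `Ψ` is injective.
  choose Ω hΩ using fun u => hΨ.exists_eq_wick h (hΨ.classical_mem_trigSymb h u)
  refine ⟨{ toFun := Ω
            map_add' := fun u v => hΨ.injective h ?_
            map_smul' := fun c u => hΨ.injective h ?_ }, (isCentralOrdering_iff hΨ h _).mpr hΩ⟩
  · rw [map_add, hΩ, hΩ, hΩ, map_add, map_add]
  · rw [map_smul, hΩ, hΩ, map_smul, map_smul, RingHom.id_apply]

theorem IsCentralOrdering.unique {hΨ : IsHeisenbergCoord Ψ} (h : IsPosSqrt σ ρ)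
    {Ω Ω' : SurfAlg.Classical ρ →ₗ[ℂ] SurfAlg ρ} (hΩ : IsCentralOrdering hΨ Ω)
    (hΩ' : IsCentralOrdering hΨ Ω') : Ω = Ω' := by
  rw [isCentralOrdering_iff hΨ h] at hΩ hΩ'
  exact LinearMap.ext fun u => hΨ.injective h ((hΩ u).trans (hΩ' u).symm)

theorem IsCentralOrdering.isOrdering {hΨ : IsHeisenbergCoord Ψ} (h : IsPosSqrt σ ρ)
    {Ω : SurfAlg.Classical ρ →ₗ[ℂ] SurfAlg ρ} (hΩ : IsCentralOrdering hΨ Ω) : IsOrdering Ω := by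
  rw [isCentralOrdering_iff hΨ h] at hΩ
  have hsec : ∀ u, SurfAlg.toClassical ρ (Ω u) = u := fun u =>
    hΨ.classical_injective h (by rw [hΨ.classical_toClassical, hΩ, Heis.classical_wick])
  exact ⟨Function.LeftInverse.injective hsec, hsec,
    hΨ.injective h (by rw [hΩ, map_one hΨ.classical, wick_one, map_one])⟩

/-! ### The Poisson bracket and the star product -/

theorem IsHeisenbergCoord.exists_commutator_eq (hΨ : IsHeisenbergCoord Ψ) (h : IsPosSqrt σ ρ)
    (x y : SurfAlg ρ) : ∃ w, x * y - y * x = Complex.I • (SurfAlg.eps ρ * w) := by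
  -- The commutator vanishes at order zero because the classical algebra is commutative.
  obtain ⟨w, hw⟩ := hΨ.exists_eps_pow_mul h (N := 1) (x := x * y - y * x) fun n hn => by
    rw [Nat.lt_one_iff.mp hn, ← Heis.classical_eq_coeffHom, map_sub, map_mul, map_mul, map_sub,
      map_mul, map_mul, mul_comm, sub_self]
  refine ⟨(-Complex.I) • w, ?_⟩
  rw [hw, pow_one, mul_smul_comm, smul_smul, mul_neg, Complex.I_mul_I, neg_neg, one_smul]

/-- Comparison of the coefficients of `ε`: the products of zeroth and first coefficients are
symmetric and cancel, which leaves `i(∂q x ∂p y - ∂q y ∂p x)`. -/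
theorem IsHeisenbergCoord.classical_commutator (hΨ : IsHeisenbergCoord Ψ) {x y w : SurfAlg ρ}
    (hw : x * y - y * x = Complex.I • (SurfAlg.eps ρ * w)) :
    hΨ.classical (SurfAlg.toClassical ρ w) =
      biPow 1 (hΨ.classical (SurfAlg.toClassical ρ x))
        (hΨ.classical (SurfAlg.toClassical ρ y)) := by
  have h1 := congrArg (fun z => Heis.coeffHom 1 (Ψ z)) hw
  simp only [map_sub, map_mul, map_smul, hΨ.map_eps, Heis.coeffHom_one_mul] at h1
  have h2 : Heis.coeffHom 1 (Complex.I • (Heis.eps a b * Ψ w)) =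
      Complex.I • Heis.coeffHom 0 (Ψ w) := by
    change Complex.I • Heis.coeffHom 1 (Heis.eps a b * Ψ w) = _
    rw [Heis.coeffHom_apply, Heis.eps_mul, PowerSeries.coeff_succ_X_mul, Heis.coeffHom_apply]
  rw [h2] at h1
  rw [biPow_one, hΨ.classical_toClassical, hΨ.classical_toClassical, hΨ.classical_toClassical]
  simp only [Heis.classical_eq_coeffHom]
  refine smul_right_injective _ Complex.I_ne_zero ?_
  change Complex.I • _ = Complex.I • _
  rw [← h1, smul_sub, mul_comm (dP a b _)]
  ring

/-- The system is triangular: `c n` enters equation `n` only through the leading coefficient of its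
Wick ordering, which is `c n` itself. -/
theorem sum_coeff_wick_injective {c c' : ℕ → Symb a b}
    (h : ∀ n, ∑ kl ∈ Finset.HasAntidiagonal.antidiagonal n,
        PowerSeries.coeff kl.2 (wick a b (c kl.1)).symb =
      ∑ kl ∈ Finset.HasAntidiagonal.antidiagonal n,
        PowerSeries.coeff kl.2 (wick a b (c' kl.1)).symb) (n : ℕ) : c n = c' n := by
  induction n using Nat.strong_induction_on with
  | _ n ih =>
    have h1 := h n
    rw [Finset.Nat.sum_antidiagonal_eq_sum_range_succ
      (fun i j => PowerSeries.coeff j (wick a b (c i)).symb),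
      Finset.Nat.sum_antidiagonal_eq_sum_range_succ
      (fun i j => PowerSeries.coeff j (wick a b (c' i)).symb), Finset.sum_range_succ,
      Finset.sum_range_succ, Nat.sub_self, coeff_wick, coeff_wick, divPow_zero,
      Module.End.one_apply, Module.End.one_apply, Finset.sum_congr rfl fun k hk => by
        rw [ih k (Finset.mem_range.mp hk)]] at h1
    exact add_left_cancel h1

theorem IsCentralOrdering.classical_of_isStarProduct {hΨ : IsHeisenbergCoord Ψ}
    (h : IsPosSqrt σ ρ) {Ω : SurfAlg.Classical ρ →ₗ[ℂ] SurfAlg ρ} (hΩ : IsCentralOrdering hΨ Ω)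
    {u v : SurfAlg.Classical ρ} {C : ℕ → SurfAlg.Classical ρ} (hC : IsStarProduct Ω u v C)
    (k : ℕ) : hΨ.classical (C k) = veyCoeff k (hΨ.classical u) (hΨ.classical v) := by
  rw [isCentralOrdering_iff hΨ h] at hΩ
  refine sum_coeff_wick_injective (c := fun k => hΨ.classical (C k))
    (c' := fun k => veyCoeff k (hΨ.classical u) (hΨ.classical v)) (fun n => ?_) k
  -- A remainder of order `n + 1` does not affect the coefficient of `εⁿ`.
  obtain ⟨y, hy⟩ := hC (n + 1)
  have h1 := congrArg (fun z => Heis.coeffHom n (Ψ z)) hy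
  simp only [map_add Ψ, map_mul, map_sum Ψ, map_pow, hΨ.map_eps, hΩ] at h1
  rw [map_add, Heis.coeffHom_apply _ (_ ^ _ * _), Heis.eps_pow_mul, PowerSeries.coeff_X_pow_mul',
    if_neg (by omega), add_zero, Heis.coeffHom_apply, Heis.coeffHom_apply,
    coeff_sum_eps_pow_mul_wick (fun k => hΨ.classical (C k)) n.lt_succ_self,
    coeff_wick_mul_wick] at h1
  exact h1.symm

/-- The Vey coefficients are trigonometric and so lift to `A⁰`. By Moyal's formula the difference
from the truncated sum has no terms below order `N`, hence lies in `ε^N` times the surface. -/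
theorem IsCentralOrdering.exists_isStarProduct {hΨ : IsHeisenbergCoord Ψ}
    (h : IsPosSqrt σ ρ) {Ω : SurfAlg.Classical ρ →ₗ[ℂ] SurfAlg ρ} (hΩ : IsCentralOrdering hΨ Ω)
    (u v : SurfAlg.Classical ρ) : ∃ C, IsStarProduct Ω u v C := by
  rw [isCentralOrdering_iff hΨ h] at hΩ
  choose C hC using fun k => hΨ.exists_classical_eq h
    (veyCoeff_mem_trigSymb (hΨ.classical_mem_trigSymb h u) (hΨ.classical_mem_trigSymb h v) k)
  refine ⟨C, fun N => ?_⟩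
  obtain ⟨y, hy⟩ := hΨ.exists_eps_pow_mul h (N := N)
    (x := Ω u * Ω v - ∑ k ∈ Finset.range N, SurfAlg.eps ρ ^ k * Ω (C k)) fun n hn => by
      simp only [map_sub, map_mul Ψ, map_sum Ψ, map_pow Ψ, hΨ.map_eps, hΩ, hC]
      rw [Heis.coeffHom_apply, Heis.coeffHom_apply, coeff_sum_eps_pow_mul_wick _ hn,
        coeff_wick_mul_wick, sub_self]
  exact ⟨y, by rw [← hy]; abel⟩

theorem IsCentralOrdering.existsUnique_isStarProduct {hΨ : IsHeisenbergCoord Ψ}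
    (h : IsPosSqrt σ ρ) {Ω : SurfAlg.Classical ρ →ₗ[ℂ] SurfAlg ρ} (hΩ : IsCentralOrdering hΨ Ω)
    (u v : SurfAlg.Classical ρ) : ∃! C, IsStarProduct Ω u v C := by
  obtain ⟨C, hC⟩ := hΩ.exists_isStarProduct h u v
  refine ⟨C, hC, fun C' hC' => funext fun k => hΨ.classical_injective h ?_⟩
  rw [hΩ.classical_of_isStarProduct h hC, hΩ.classical_of_isStarProduct h hC']

end Coordinates

end

/-! ### The central ordering and the Vey product -/

theorem mainTheorem9 (a b : EReal) (hab : a < b) (ρ : ℝ → ℝ → ℝ)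
    (hρ : ∀ z ∈ realIoo a b, AnalyticAt ℝ (fun x : ℝ × ℝ => ρ x.1 x.2) (z, 0))
    (hpos : ∀ z ∈ realIoo a b, 0 < ρ z 0) :
    (∃! Ω_W : Symb a b →ₗ[ℂ] Heis a b, IsWickOrdering Ω_W) ∧
    (∃! Ψ : SurfAlg (epsTaylor ρ hρ) →ₐ[ℂ] Heis a b, IsHeisenbergCoord Ψ) ∧
    ∀ (Ω_W : Symb a b →ₗ[ℂ] Heis a b) (_ : IsWickOrdering Ω_W)
      (Ψ : SurfAlg (epsTaylor ρ hρ) →ₐ[ℂ] Heis a b) (hΨ : IsHeisenbergCoord Ψ),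
      Function.Injective Ψ ∧ Function.Injective hΨ.classical ∧
      (∃! Ω_C, IsCentralOrdering hΨ Ω_C) ∧
      ∀ Ω_C, IsCentralOrdering hΨ Ω_C →
        IsOrdering Ω_C ∧
        -- the central ordering is compatible with the Wick ordering
        (∀ u, Ψ (Ω_C u) = Ω_W (hΨ.classical u)) ∧
        -- `P` is the Poisson bracket `{π x, π y} = π ([x, y] / (iε))`
        (∀ x y, ∃ w, x * y - y * x = Complex.I • (SurfAlg.eps _ * w) ∧
          ∀ w', x * y - y * x = Complex.I • (SurfAlg.eps _ * w') →
            hΨ.classical (SurfAlg.toClassical _ w') =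
              biPow 1 (hΨ.classical (SurfAlg.toClassical _ x))
                (hΨ.classical (SurfAlg.toClassical _ y))) ∧
        -- the star product of the central ordering is the Vey product
        (∀ u v, (∃! C, IsStarProduct Ω_C u v C) ∧
          ∀ C, IsStarProduct Ω_C u v C →
            ∀ k, hΨ.classical (C k) = veyCoeff k (hΨ.classical u) (hΨ.classical v)) := by
  obtain ⟨σ, h⟩ := exists_isPosSqrt (epsTaylor_isPos hρ hpos)
  refine ⟨⟨wick a b, wick_isWickOrdering a b, fun _ hΩ => hΩ.unique (wick_isWickOrdering a b)⟩,
    ⟨heisCoord h, heisCoord_isHeisenbergCoord h,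
      fun _ hΨ => hΨ.unique (heisCoord_isHeisenbergCoord h) h⟩, fun Ω_W hW Ψ hΨ => ?_⟩
  obtain ⟨Ω₀, hΩ₀⟩ := exists_centralOrdering hΨ h
  refine ⟨hΨ.injective h, hΨ.classical_injective h, ⟨Ω₀, hΩ₀, fun _ hΩ => hΩ.unique h hΩ₀⟩,
    fun Ω_C hΩ => ⟨hΩ.isOrdering h, ?_, fun x y => ?_, fun u v =>
      ⟨hΩ.existsUnique_isStarProduct h u v, fun C hC => hΩ.classical_of_isStarProduct h hC⟩⟩⟩
  -- By uniqueness the given Wick ordering is the exponential one, for which the claim characterises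
  -- central orderings.
  · rw [hW.unique (wick_isWickOrdering a b)]
    exact (isCentralOrdering_iff hΨ h Ω_C).mp hΩ
  · obtain ⟨w, hw⟩ := hΨ.exists_commutator_eq h x y
    exact ⟨w, hw, fun w' hw' => hΨ.classical_commutator hw'⟩
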